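/- The following is provable in $\mathsf{ACA}_0$, i.e. it holds (with all notions interpreted internally) in every model of $\mathsf{ACA}_0$. **Setting.** Let $G=\{g_i\}_{i\in\mathbb N}$ be a set of generators. An *expression* is a family $\langle p_k\rangle_{k\in I}$, $I\subseteq\mathbb N$, of finite subsets of $G$, written $a=\bigvee_{k\in I}p_k$, where $p_k$ stands for the finite meet $\bigwedge_{g\in p_k}g$; two expressions are identified if they join the same finite meets. For $a=\bigvee_k p_k$ and $b=\bigvee_j q_j$ put $a\wedge b=\bigvee_{k,j}(p_k\cup q_j)$, and $a\le b$ iff for every $k$ there is $j$ with $q_j\subseteq p_k$. A *countably presented frame* $\langle G;R\rangle$ is given by $G$ and a sequence $R=\{(u_j,v_j)\}_{j\in\mathbb N}$ of pairs of expressions. The *deductive relation* $a\vdash b$ holds iff there are a well-founded tree $T\subseteq\mathbb N^{<\mathbb N}$ (a tree with no infinite path) and a sequence of pairs of expressions $\langle(a_\sigma,b_\sigma):\sigma\in T\rangle$ with $(a_{\langle\rangle},b_{\langle\rangle})=(a,b)$ such that every $\sigma\in T$ satisfies one of the following: 0. (Axiom) $a_\sigma\le b_\sigma$. 1. (Base case)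 $(a_\sigma,b_\sigma)=(c\wedge u,\,d\wedge v)$ for some $(u,v)\in R$ and some expressions $c\le d$. 2. (Cut) $\sigma^\frown\langle 0\rangle,\sigma^\frown\langle 1\rangle\in T$, $a_\sigma=a_{\sigma^\frown\langle 0\rangle}$, $b_{\sigma^\frown\langle 0\rangle}=a_{\sigma^\frown\langle 1\rangle}$ and $b_{\sigma^\frown\langle 1\rangle}=b_\sigma$. 3. (Left join) $a_\sigma=\bigvee_i p_i$; every child $\sigma^\frown\langle m\rangle\in T$ has $b_{\sigma^\frown\langle m\rangle}=b_\sigma$; and for every $i$ there is a child $\sigma^\frown\langle m\rangle\in T$ with $a_{\sigma^\frown\langle m\rangle}=p_i$. 4. (Right join) $b_\sigma=\bigvee_h q_h$, and for some $h$ there is a child $\sigma^\frown\langle m\rangle\in T$ with $b_{\sigma^\frown\langle m\rangle}=q_h$ and $a_{\sigma^\frown\langle m\rangle}=a_\sigma$. Identify $\mathcal P(G)$ with $\mathcal P(\mathbb N)$ (via $g_i\mapsto i$), with the topology generated by the sets $\{x: p\subseteq x\}$, $p$ finite. For an expression $a=\bigvee_k p_k$ let $U_a=\{x\in\mathcal P(\mathbb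 N):\exists k\ p_k\subseteq x\}$, and put $$X=\bigcap_{j\in\mathbb N}\bigl(U_{v_j}\cup(\mathcal P(\mathbb N)\setminus U_{u_j})\bigr),\qquad f(a)=X\cap U_a .$$ **Statement.** For every countably presented frame $\langle G;R\rangle$: * $X$ is a $\mathbf\Pi^0_2$ subspace of $\mathcal P(\mathbb N)$, and it is the space of points of $\langle G;R\rangle$, i.e. of those $x\subseteq G$ for which the relation $x\in U_a\Rightarrow x\in U_b$ between expressions $a,b$ is a congruence preorder (it is transitive, contains $\le$, and contains $R$). * $\langle G;R\rangle$ with the preorder $\vdash$ is spatial, through $X$: finite meets and countable joins of expressions exist, $f$ maps the expressions onto the open subsets of $X$ and takes the top element to $X$, binary meets to intersections and countable joins to unions, and for all expressions $a,b$ $$a\vdash b\iff\forall x\in X\,\bigl(x\in f(a)\rightarrow x\in f(b)\bigr).$$ Hence $f$ induces an isomorphism from the frame of expressions modulo $\vdash$ onto the frame of open sets of $X$. -/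

import Mathlib

universe u

/-! ### Second-order arithmetic and its subsystem `ACA₀` -/

/-- A structure for the language of second-order arithmetic (Henkin semantics): a number domain
with `0, 1, +, ·, <`, and a nonempty collection of sets of numbers as the range of the set
variables. The relation symbol `∈` is interpreted by membership. -/
structure SOAStructure : Type (u + 1) where
  Num : Type u
  zero : Num
  one : Num
  add : Num → Num → Num
  mul : Num → Num → Num
  lt : Num → Num → Prop
  sets : Set (Set Num)
  sets_nonempty : sets.Nonempty

namespace SOAStructure

instance (S : SOAStructure.{u}) : Zero S.Num := ⟨S.zero⟩
instance (S : SOAStructure.{u}) : One S.Num := ⟨S.one⟩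
instance (S : SOAStructure.{u}) : Add S.Num := ⟨S.add⟩
instance (S : SOAStructure.{u}) : Mul S.Num := ⟨S.mul⟩
instance (S : SOAStructure.{u}) : LT S.Num := ⟨S.lt⟩

/-- The function symbols `0, 1, +, ·`. -/
inductive ArithFunc : ℕ → Type
  | zero : ArithFunc 0
  | one : ArithFunc 0
  | add : ArithFunc 2
  | mul : ArithFunc 2

/-- The relation symbols: `<`, and for every set `X` of the structure a unary symbol `· ∈ X`. -/
inductive ArithRel (S : SOAStructure.{u}) : ℕ → Type u
  | lt : ArithRel S 2
  | mem (X : S.sets) : ArithRel S 1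

/-- The language of arithmetical formulas with set parameters from `S`: first-order formulas have
number quantifiers only. -/
def arithLang (S : SOAStructure.{u}) : FirstOrder.Language.{0, u} := ⟨ArithFunc, ArithRel S⟩

instance (S : SOAStructure.{u}) : S.arithLang.Structure S.Num where
  funMap {_} f := match f with
    | ArithFunc.zero => fun _ => 0
    | ArithFunc.one => fun _ => 1
    | ArithFunc.add => fun v => v 0 + v 1
    | ArithFunc.mul => fun v => v 0 * v 1
  RelMap {_} r := match r with
    | ArithRel.lt => fun v => v 0 < v 1
    | ArithRel.mem X => fun v => v 0 ∈ X.1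

/-- `X` is defined in `S` by an arithmetical formula with number and set parameters. -/
def IsArithmetical (S : SOAStructure.{u}) (X : Set S.Num) : Prop :=
  (Set.univ : Set S.Num).Definable₁ S.arithLang X

end SOAStructure

/-- The axioms of `ACA₀`: the basic axioms, the induction axiom, and arithmetical comprehension. -/
structure IsACA0 (S : SOAStructure.{u}) : Prop where
  add_one_ne_zero : ∀ n : S.Num, n + 1 ≠ 0
  add_one_inj : ∀ m n : S.Num, m + 1 = n + 1 → m = n
  add_zero : ∀ m : S.Num, m + 0 = m
  add_add_one : ∀ m n : S.Num, m + (n + 1) = (m + n) + 1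
  mul_zero : ∀ m : S.Num, m * 0 = 0
  mul_add_one : ∀ m n : S.Num, m * (n + 1) = m * n + m
  not_lt_zero : ∀ m : S.Num, ¬ m < 0
  lt_add_one_iff : ∀ m n : S.Num, m < n + 1 ↔ m < n ∨ m = n
  induction : ∀ X ∈ S.sets, (0 ∈ X ∧ ∀ n, n ∈ X → n + 1 ∈ X) → ∀ n, n ∈ X
  comprehension : ∀ X : Set S.Num, S.IsArithmetical X → X ∈ S.sets

/-- Models of `ACA₀`. -/
structure ACA0Model : Type (u + 1) extends SOAStructure.{u} where
  isACA0 : IsACA0 toSOAStructure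

namespace ACA0Model

variable {M : ACA0Model.{u}}

/-! ### Coding inside a model -/

/-- The usual pairing function `(i, j) = (i + j)² + i`. -/
def pair (i j : M.Num) : M.Num := (i + j) * (i + j) + i

/-- The code of the finite sequence `σ⌢⟨m⟩`. The code of the empty sequence is `0`; the codes
generated in this way represent `ℕ^{<ℕ}` inside the model. -/
def snoc (s m : M.Num) : M.Num := pair s m + 1

/-- The function `h` belongs to the model. -/
def IsFun (h : M.Num → M.Num) : Prop := {n | ∃ i, n = pair i (h i)} ∈ M.sets

/-- `T` is a tree of finite sequences: a set of codes of sequences, containing the empty sequence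
and closed under initial segments. -/
structure IsTree (T : Set M.Num) : Prop where
  mem_sets : T ∈ M.sets
  root_mem : 0 ∈ T
  parent : ∀ s ∈ T, s = 0 ∨ ∃ t ∈ T, ∃ m, s = snoc t m

/-- An infinite path through `T`, given by the sequence `h 0 = ⟨⟩, h 1, h 2, …` of its initial
segments. -/
def IsPath (T : Set M.Num) (h : M.Num → M.Num) : Prop :=
  IsFun h ∧ h 0 = 0 ∧ (∀ n, ∃ m, h (n + 1) = snoc (h n) m) ∧ ∀ n, h n ∈ T

/-- The tree `T` is well-founded in the model: the model has no infinite path through it. -/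
def WellFoundedTree (T : Set M.Num) : Prop := IsTree T ∧ ¬ ∃ h, IsPath T h

/-! ### Families of finite sets: expressions, and codes of open subsets of `P(ℕ)` -/

variable (M) in
/-- A family `⟨f_k⟩`, `k ∈ I ⊆ ℕ`, of finite sets of numbers that belongs to the model (a set of
the model is finite in the sense of the model if and only if it is bounded). As an
expression over the generators `g_0, g_1, …` it denotes `⋁_{k ∈ I} ⋀_{i ∈ f_k} g_i`; as a code it
denotes the open set of all `x` that include some `f_k`. The value of `term` outside of `idx` is
irrelevant. -/
structure Family : Type u where
  idx : Set M.Num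
  term : M.Num → Set M.Num
  idx_mem : idx ∈ M.sets
  term_mem : {n | ∃ k g, n = pair k g ∧ k ∈ idx ∧ g ∈ term k} ∈ M.sets
  bounded : ∀ k ∈ idx, ∃ b, ∀ g ∈ term k, g < b

/-- The sequence `⟨s 0, s 1, …⟩` of families belongs to the model. -/
def IsFamilySeq (s : M.Num → Family M) : Prop :=
  {n | ∃ i k, n = pair i k ∧ k ∈ (s i).idx} ∈ M.sets ∧
  {n | ∃ i k g, n = pair (pair i k) g ∧ k ∈ (s i).idx ∧ g ∈ (s i).term k} ∈ M.sets

namespace Family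

/-- The collection of the finite meets that are joined in the expression. -/
def members (a : Family M) : Set (Set M.Num) := {p | ∃ k ∈ a.idx, p = a.term k}

/-- `a` and `b` are the same formal join of finite meets. -/
def Same (a b : Family M) : Prop := a.members = b.members

/-- `a` is the finite meet `⋀_{i ∈ p} g_i`. -/
def IsMeetOf (a : Family M) (p : Set M.Num) : Prop := a.members = {p}

/-- `c = a ∧ b`, by the distributive law the join of all `p_i ∧ q_j`. -/
def IsInf (c a b : Family M) : Prop :=
  c.members = {r | ∃ p ∈ a.members, ∃ q ∈ b.members, r = p ∪ q}

/-- `c = ⋁_i s i`. -/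
def IsSup (c : Family M) (s : M.Num → Family M) : Prop :=
  c.members = {r | ∃ i, r ∈ (s i).members}

/-- The preorder `a ≤ b` of expressions (that of the free frame). -/
def Le (a b : Family M) : Prop := ∀ p ∈ a.members, ∃ q ∈ b.members, q ⊆ p

/-- The open subset of `P(ℕ)` coded by `a`; the points of `P(ℕ)` are the sets of the model. -/
def openSet (a : Family M) : Set (Set M.Num) := {x | x ∈ M.sets ∧ ∃ p ∈ a.members, p ⊆ x}

end Family

/-- `Y` is a `Π⁰₂` subspace of `P(ℕ)`: there are sequences `B`, `C` of codes of open sets in the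
model with `Y = ⋂_i (B_i ∪ (P(ℕ) \ C_i))`. -/
def IsPi02 (Y : Set (Set M.Num)) : Prop :=
  ∃ B C : M.Num → Family M, IsFamilySeq B ∧ IsFamilySeq C ∧
    Y = {x | x ∈ M.sets ∧ ∀ i, x ∈ (B i).openSet ∨ x ∉ (C i).openSet}

/-- `U` is an open subset of the subspace `X` of `P(ℕ)`, i.e. an element of the frame `O(X)`. -/
def IsOpenIn (X U : Set (Set M.Num)) : Prop := ∃ a : Family M, U = X ∩ a.openSet

/-! ### Countably presented frames -/

variable (M) in
/-- A countably presented frame `⟨G; R⟩` in the model: the generators are `g_0, g_1, …`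
(represented by their indices), the relations are `R = {(u_j, v_j) : j ∈ ℕ}`. -/
structure PresentedFrame : Type u where
  u : M.Num → Family M
  v : M.Num → Family M
  u_seq : IsFamilySeq u
  v_seq : IsFamilySeq v

namespace PresentedFrame

variable (F : PresentedFrame M)

/-- The inference rules, at the node `s` of a tree `T` whose node `t` is labelled with the
sequent `a t ⊢ b t`. -/
inductive Rule (T : Set M.Num) (a b : M.Num → Family M) (s : M.Num) : Prop
  /-- Logical axiom: `a ⊢ b` if `a ≤ b`. -/
  | ax (h : (a s).Le (b s)) : Rule T a b s
  /-- Base case: `c ∧ u ⊢ d ∧ v` if `(u, v) ∈ R` and `c ≤ d`. -/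
  | base (j : M.Num) (c d : Family M) (h : c.Le d)
      (ha : (a s).IsInf c (F.u j)) (hb : (b s).IsInf d (F.v j)) : Rule T a b s
  /-- Cut: from `a ⊢ c` and `c ⊢ b` infer `a ⊢ b`. -/
  | cut (h0 : snoc s 0 ∈ T) (h1 : snoc s 1 ∈ T)
      (ha : (a s).Same (a (snoc s 0))) (hc : (b (snoc s 0)).Same (a (snoc s 1)))
      (hb : (b (snoc s 1)).Same (b s)) : Rule T a b s
  /-- Left join: from `p_i ⊢ b` for all `i` infer `⋁_i p_i ⊢ b`. -/
  | left (hb : ∀ m, snoc s m ∈ T → (b (snoc s m)).Same (b s))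
      (ha : ∀ p ∈ (a s).members, ∃ m, snoc s m ∈ T ∧ (a (snoc s m)).IsMeetOf p) : Rule T a b s
  /-- Right join: from `a ⊢ q_h` for some `h` infer `a ⊢ ⋁_h q_h`. -/
  | right (q : Set M.Num) (hq : q ∈ (b s).members) (m : M.Num) (hm : snoc s m ∈ T)
      (hb : (b (snoc s m)).IsMeetOf q) (ha : (a (snoc s m)).Same (a s)) : Rule T a b s

/-- The deductive relation `a ⊢ b`: the model has a well-founded proof tree with root `a ⊢ b`. -/
def Deduces (a b : Family M) : Prop :=
  ∃ (T : Set M.Num) (l r : M.Num → Family M),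
    WellFoundedTree T ∧ IsFamilySeq l ∧ IsFamilySeq r ∧
    (l 0).Same a ∧ (r 0).Same b ∧ ∀ s ∈ T, F.Rule T l r s

/-- A congruence preorder on the expressions of `⟨G; R⟩`. -/
structure IsCongruencePreorder (prec : Family M → Family M → Prop) : Prop where
  of_le : ∀ a b : Family M, a.Le b → prec a b
  of_rel : ∀ j, prec (F.u j) (F.v j)
  trans : ∀ a b c : Family M, prec a b → prec b c → prec a c

/-- The point space of `⟨G; R⟩`: a point is a set `x` of generators for which the relation
"if `x` satisfies `a` then `x` satisfies `b`" is a congruence preorder. -/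
def pointSpace : Set (Set M.Num) :=
  {x | x ∈ M.sets ∧ F.IsCongruencePreorder (fun a b => x ∈ a.openSet → x ∈ b.openSet)}

/-- The subspace `⋂_j (V_j ∪ (P(ℕ) \ U_j))` of `P(ℕ)` cut out by the relations `(u_j, v_j)`. -/
def relationSpace : Set (Set M.Num) :=
  {x | x ∈ M.sets ∧ ∀ j, x ∈ (F.v j).openSet ∨ x ∉ (F.u j).openSet}

end PresentedFrame

/-- The expressions with the preorder `prec` are spatial, through the space `X ⊆ P(ℕ)` and the
map `f`: the map `f` induces an isomorphism from the frame of expressions modulo `prec` onto the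
frame `O(X)` of open sets of `X`, and `prec a b` holds if and only if every point of `X` that lies
in `f a` lies in `f b`. -/
structure IsSpatialVia (prec : Family M → Family M → Prop) (X : Set (Set M.Num))
    (f : Family M → Set (Set M.Num)) : Prop where
  isOpen : ∀ a, IsOpenIn X (f a)
  surjective : ∀ U, IsOpenIn X U → ∃ a, f a = U
  exists_top : ∃ c : Family M, c.IsMeetOf ∅
  map_top : ∀ c : Family M, c.IsMeetOf ∅ → f c = X
  exists_inf : ∀ a b : Family M, ∃ c : Family M, c.IsInf a b
  map_inf : ∀ a b c : Family M, c.IsInf a b → f c = f a ∩ f b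
  exists_sup : ∀ s : M.Num → Family M, IsFamilySeq s → ∃ c : Family M, c.IsSup s
  map_sup : ∀ (s : M.Num → Family M) (c : Family M), IsFamilySeq s → c.IsSup s →
    f c = ⋃ i, f (s i)
  le_iff : ∀ a b, prec a b ↔ ∀ x ∈ X, x ∈ f a → x ∈ f b

end ACA0Model

/-!
The argument is that of the completeness theorem for `ω`-logic, carried out inside a model of
`ACA₀`.

*Soundness* (`Deduces.sound`). If a point `x` of `X` refutes the sequent at a node of a proof tree,
then it refutes the sequent at one of the children (`Rule.exists_child`). As the set of the refuted
nodes is arithmetical, the path that always passes to the least refuted child belongs to the model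
(`exists_isPath`). So a sequent that is refuted by a point of `X` has no well-founded proof tree.

*Completeness* (`Deduces.complete`). For all `a` and `b` there is a search tree, which satisfies the
inference rules at every node and has the sequent `a ⊢ b` at its root (`searchTree_rule`). By left
join the root leads to sequents `p ⊢ b` with a finite meet `p`. Such a node is an axiom if `p ≤ b`.
Otherwise the search considers a relation `(u_j, v_j)`, every relation having its turn infinitely
often. If `p ≤ u_j`, then `p ⊢ b` is obtained by a cut from `p ⊢ p ∧ v_j` and `p ∧ v_j ⊢ b`. The
first is provable by another cut, from the axiom `p ⊢ p ∧ u_j` and the base case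
`p ∧ u_j ⊢ p ∧ v_j`; the second follows from the sequents `p ∧ q ⊢ b` for the finite meets `q` in
`v_j`. If `p ≤ u_j` fails, the top element takes the place of `v_j`, and `p` stays as it is. If the
tree has a path, the union of the sets `p` along it is a point of `X` in `U_a` but not in `U_b`
(`exists_point_of_isPath`); if it has no path, the tree is a proof of `a ⊢ b`.

Both parts need some arithmetic in the model. Induction is available for arithmetical predicates,
and makes the numbers of the model a discretely ordered semiring. A bounded set of the model is
coded by a number, through divisibility by pairwise coprime moduli as in Gödel's `β` function
(`exists_decode_eq_of_bounded`); the codes yield sets that are defined by recursion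
(`exists_recursive_set`), in particular the search tree and the paths.
-/

namespace ACA0Model

open FirstOrder

variable {M : ACA0Model.{u}}

/-! ### Arithmetical relations and functions -/

/-- The relation `P` on the numbers of the model is arithmetical (with parameters). This is a class,
and so is `ArithFun`, so that instance search proves the definability of explicit formulas, by
recursion on their structure. -/
class Arith {n : ℕ} (P : (Fin n → M.Num) → Prop) : Prop where
  definable : (Set.univ : Set M.Num).Definable M.arithLang {v | P v}

/-- The function `f` on the numbers of the model has an arithmetical graph. -/
class ArithFun {n : ℕ} (f : (Fin n → M.Num) → M.Num) : Prop where
  graph : Arith fun w : Fin (n + 1) → M.Num => w (Fin.last n) = f fun i => w i.castSucc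

theorem mem_sets_of_arith {P : M.Num → Prop} [h : Arith fun v : Fin 1 → M.Num => P (v 0)] :
    {x | P x} ∈ M.sets :=
  M.isACA0.comprehension _ h.definable

section Closure

variable {m n : ℕ}

theorem Arith.congr {P Q : (Fin n → M.Num) → Prop} (hP : Arith P) (h : ∀ v, Q v ↔ P v) :
    Arith Q := by
  obtain rfl : P = Q := funext fun v => propext (h v).symm
  exact hP

instance Arith.and {P Q : (Fin n → M.Num) → Prop} [hP : Arith P] [hQ : Arith Q] :
    Arith fun v => P v ∧ Q v :=
  ⟨hP.definable.inter hQ.definable⟩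

instance Arith.or {P Q : (Fin n → M.Num) → Prop} [hP : Arith P] [hQ : Arith Q] :
    Arith fun v => P v ∨ Q v :=
  ⟨hP.definable.union hQ.definable⟩

instance Arith.not {P : (Fin n → M.Num) → Prop} [hP : Arith P] : Arith fun v => ¬ P v :=
  ⟨hP.definable.compl⟩

instance Arith.imp {P Q : (Fin n → M.Num) → Prop} [Arith P] [Arith Q] :
    Arith fun v => P v → Q v :=
  Arith.congr (P := fun v => ¬ P v ∨ Q v) inferInstance fun _ => imp_iff_not_or

instance Arith.iff {P Q : (Fin n → M.Num) → Prop} [Arith P] [Arith Q] :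
    Arith fun v => P v ↔ Q v :=
  Arith.congr (P := fun v => (P v → Q v) ∧ (Q v → P v)) inferInstance fun _ => iff_def

/-- A relation remains arithmetical when its variables are renamed. -/
theorem Arith.rename {P : (Fin n → M.Num) → Prop} (hP : Arith P) (ρ : Fin n → Fin m) :
    Arith fun w : Fin m → M.Num => P fun i => w (ρ i) :=
  ⟨hP.definable.preimage_comp ρ⟩

instance Arith.exists {P : (Fin n → M.Num) → M.Num → Prop}
    [hP : Arith fun w : Fin (n + 1) → M.Num => P (fun i => w i.castSucc) (w (Fin.last n))] :
    Arith fun v => ∃ x, P v x := by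
  refine ⟨?_⟩
  convert hP.definable.image_comp (Fin.castSucc : Fin n → Fin (n + 1)) using 1
  ext v
  constructor
  · rintro ⟨x, hx⟩
    exact ⟨Fin.snoc v x, by simpa using hx, by ext i; simp⟩
  · rintro ⟨w, hw, rfl⟩
    exact ⟨_, hw⟩

instance Arith.forall {P : (Fin n → M.Num) → M.Num → Prop}
    [hP : Arith fun w : Fin (n + 1) → M.Num => P (fun i => w i.castSucc) (w (Fin.last n))] :
    Arith fun v => ∀ x, P v x :=
  Arith.congr (P := fun v => ¬ ∃ x, ¬ P v x) inferInstance fun _ => by simp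

theorem ArithFun.graph_rename {f : (Fin n → M.Num) → M.Num} (hf : ArithFun f) (ρ : Fin n → Fin m)
    (j : Fin m) : Arith fun w : Fin m → M.Num => w j = f fun i => w (ρ i) :=
  (hf.graph.rename (Fin.snoc ρ j : Fin (n + 1) → Fin m)).congr fun w => by simp

/-- Substitution of an arithmetical function for the last variable: `P v (f v)` holds if and only if
`P v x` holds for some `x` with `x = f v`. -/
theorem Arith.subst {P : (Fin n → M.Num) → M.Num → Prop} {f : (Fin n → M.Num) → M.Num}
    (hP : Arith fun w : Fin (n + 1) → M.Num => P (fun i => w i.castSucc) (w (Fin.last n)))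
    (hf : ArithFun f) : Arith fun v => P v (f v) := by
  have := hf.graph
  exact Arith.congr (P := fun v => ∃ x, x = f v ∧ P v x) inferInstance fun v => by simp

theorem Arith.comp₁ {P : M.Num → Prop} (hP : Arith fun v : Fin 1 → M.Num => P (v 0))
    {f : (Fin n → M.Num) → M.Num} (hf : ArithFun f) : Arith fun v => P (f v) :=
  Arith.subst (P := fun _ x => P x) (hP.rename fun _ => Fin.last n) hf

theorem ArithFun.weaken {f : (Fin n → M.Num) → M.Num} (hf : ArithFun f) :
    ArithFun fun w : Fin (n + 1) → M.Num => f fun i => w i.castSucc :=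
  ⟨hf.graph_rename (fun i => i.castSucc.castSucc) (Fin.last _)⟩

theorem Arith.comp₂ {P : M.Num → M.Num → Prop}
    (hP : Arith fun v : Fin 2 → M.Num => P (v 0) (v 1))
    {f g : (Fin n → M.Num) → M.Num} (hf : ArithFun f) (hg : ArithFun g) :
    Arith fun v => P (f v) (g v) :=
  Arith.subst (P := fun v x => P x (g v)) (f := f)
    (Arith.subst (P := fun (w : Fin (n + 1) → M.Num) y => P (w (Fin.last n)) y)
      (hP.rename ![(Fin.last n).castSucc, Fin.last (n + 1)]) hg.weaken) hf

theorem Arith.comp₃ {P : M.Num → M.Num → M.Num → Prop}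
    (hP : Arith fun v : Fin 3 → M.Num => P (v 0) (v 1) (v 2))
    {f g h : (Fin n → M.Num) → M.Num} (hf : ArithFun f) (hg : ArithFun g) (hh : ArithFun h) :
    Arith fun v => P (f v) (g v) (h v) :=
  Arith.subst (P := fun v x => P x (g v) (h v)) (f := f)
    (Arith.subst (P := fun (w : Fin (n + 1) → M.Num) y => P (w (Fin.last n)) y
        (h fun i => w i.castSucc))
      (Arith.subst (P := fun (w : Fin (n + 2) → M.Num) z =>
          P (w (Fin.last n).castSucc) (w (Fin.last (n + 1))) z)
        (hP.rename ![(Fin.last n).castSucc.castSucc, (Fin.last (n + 1)).castSucc, Fin.last (n + 2)])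
        hh.weaken.weaken) hg.weaken) hf

theorem ArithFun.comp₁ {F : M.Num → M.Num} (hF : Arith fun v : Fin 2 → M.Num => v 1 = F (v 0))
    {f : (Fin n → M.Num) → M.Num} (hf : ArithFun f) : ArithFun fun v => F (f v) :=
  ⟨Arith.subst (P := fun (w : Fin (n + 1) → M.Num) x => w (Fin.last n) = F x)
    (hF.rename ![Fin.last (n + 1), (Fin.last n).castSucc]) hf.weaken⟩

theorem ArithFun.comp₂ {F : M.Num → M.Num → M.Num}
    (hF : Arith fun v : Fin 3 → M.Num => v 2 = F (v 0) (v 1))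
    {f g : (Fin n → M.Num) → M.Num} (hf : ArithFun f) (hg : ArithFun g) :
    ArithFun fun v => F (f v) (g v) :=
  ⟨Arith.subst (P := fun (w : Fin (n + 1) → M.Num) x =>
      w (Fin.last n) = F x (g fun i => w i.castSucc))
    (Arith.subst (P := fun (w : Fin (n + 2) → M.Num) y =>
        w (Fin.last n).castSucc = F (w (Fin.last (n + 1))) y)
      (hF.rename ![(Fin.last (n + 1)).castSucc, Fin.last (n + 2), (Fin.last n).castSucc.castSucc])
      hg.weaken.weaken) hf.weaken⟩

end Closure

section Atomic

variable {n : ℕ}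

theorem arith_eq_var (i j : Fin n) : Arith fun v : Fin n → M.Num => v i = v j :=
  ⟨⟨(Language.Term.var i).equal (Language.Term.var j), by
    ext v; simp [Language.Formula.realize_equal]⟩⟩

instance ArithFun.var (i : Fin n) : ArithFun fun v : Fin n → M.Num => v i :=
  ⟨arith_eq_var _ _⟩

instance ArithFun.const (a : M.Num) : ArithFun fun _ : Fin n → M.Num => a :=
  ⟨⟨⟨(Language.Term.var (Fin.last n)).equal
    (Language.Constants.term (M.arithLang.con (⟨a, Set.mem_univ a⟩ : (Set.univ : Set M.Num)))), by
    ext v; simp [Language.Formula.realize_equal]⟩⟩⟩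

theorem arith_of_formula {P : (Fin n → M.Num) → Prop} (φ : M.arithLang.Formula (Fin n))
    (h : ∀ v, φ.Realize v ↔ P v) : Arith P := by
  refine ⟨(Set.empty_definable_iff.2 ⟨φ, ?_⟩ : (∅ : Set M.Num).Definable _ _).mono
    (Set.empty_subset _)⟩
  ext v
  exact (h v).symm

instance Arith.eq {f g : (Fin n → M.Num) → M.Num} [hf : ArithFun f] [hg : ArithFun g] :
    Arith fun v => f v = g v :=
  Arith.comp₂ (P := fun x y => x = y) (arith_eq_var 0 1) hf hg

instance Arith.lt {f g : (Fin n → M.Num) → M.Num} [hf : ArithFun f] [hg : ArithFun g] :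
    Arith fun v => f v < g v :=
  Arith.comp₂ (P := fun x y => x < y)
    (arith_of_formula (Language.Relations.formula (L := M.arithLang) (n := 2)
      SOAStructure.ArithRel.lt
      ![Language.Term.var 0, Language.Term.var 1]) fun _ =>
        Language.Formula.realize_rel.trans Iff.rfl) hf hg

theorem Arith.mem {X : Set M.Num} (hX : X ∈ M.sets) {f : (Fin n → M.Num) → M.Num}
    [hf : ArithFun f] : Arith fun v => f v ∈ X :=
  Arith.comp₁ (P := fun x => x ∈ X)
    (arith_of_formula (Language.Relations.formula (L := M.arithLang) (n := 1)
      (SOAStructure.ArithRel.mem ⟨X, hX⟩) ![Language.Term.var 0]) fun _ =>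
        Language.Formula.realize_rel.trans Iff.rfl) hf

instance Arith.mem_fact {X : Set M.Num} [hX : Fact (X ∈ M.sets)] {f : (Fin n → M.Num) → M.Num}
    [ArithFun f] : Arith fun v => f v ∈ X :=
  Arith.mem hX.out

instance ArithFun.add {f g : (Fin n → M.Num) → M.Num} [hf : ArithFun f] [hg : ArithFun g] :
    ArithFun fun v => f v + g v :=
  ArithFun.comp₂ (F := fun x y => x + y)
    (arith_of_formula ((Language.Term.var 2).equal (Language.Functions.apply₂ (L := M.arithLang)
      SOAStructure.ArithFunc.add (Language.Term.var 0) (Language.Term.var 1))) fun _ =>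
        Language.Formula.realize_equal.trans Iff.rfl) hf hg

instance ArithFun.mul {f g : (Fin n → M.Num) → M.Num} [hf : ArithFun f] [hg : ArithFun g] :
    ArithFun fun v => f v * g v :=
  ArithFun.comp₂ (F := fun x y => x * y)
    (arith_of_formula ((Language.Term.var 2).equal (Language.Functions.apply₂ (L := M.arithLang)
      SOAStructure.ArithFunc.mul (Language.Term.var 0) (Language.Term.var 1))) fun _ =>
        Language.Formula.realize_equal.trans Iff.rfl) hf hg

instance ArithFun.pair {f g : (Fin n → M.Num) → M.Num} [ArithFun f] [ArithFun g] :
    ArithFun fun v => pair (f v) (g v) := by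
  unfold ACA0Model.pair; infer_instance

instance ArithFun.snoc {f g : (Fin n → M.Num) → M.Num} [ArithFun f] [ArithFun g] :
    ArithFun fun v => snoc (f v) (g v) := by
  unfold ACA0Model.snoc; infer_instance

end Atomic

/-! ### The numbers of the model form a discretely ordered semiring -/

/-- Induction for arithmetical predicates. -/
@[elab_as_elim]
theorem arith_induction {P : M.Num → Prop} (n : M.Num)
    (hP : Arith fun v : Fin 1 → M.Num => P (v 0))
    (zero : P 0) (succ : ∀ n, P n → P (n + 1)) : P n :=
  M.isACA0.induction {x | P x} mem_sets_of_arith ⟨zero, succ⟩ n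

theorem num_zero_add (a : M.Num) : 0 + a = a := by
  induction a using arith_induction with
  | hP => infer_instance
  | zero => exact M.isACA0.add_zero 0
  | succ a ih => rw [M.isACA0.add_add_one, ih]

theorem num_add_one_comm (a b : M.Num) : a + 1 + b = a + b + 1 := by
  induction b using arith_induction with
  | hP => infer_instance
  | zero => rw [M.isACA0.add_zero, M.isACA0.add_zero]
  | succ b ih => rw [M.isACA0.add_add_one, ih, M.isACA0.add_add_one]

theorem num_add_comm (a b : M.Num) : a + b = b + a := by
  induction b using arith_induction with
  | hP => infer_instance
  | zero => rw [M.isACA0.add_zero, num_zero_add]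
  | succ b ih => rw [M.isACA0.add_add_one, ih, num_add_one_comm]

theorem num_add_assoc (a b c : M.Num) : a + b + c = a + (b + c) := by
  induction c using arith_induction with
  | hP => infer_instance
  | zero => rw [M.isACA0.add_zero, M.isACA0.add_zero]
  | succ c ih => rw [M.isACA0.add_add_one, ih, M.isACA0.add_add_one, M.isACA0.add_add_one]

instance : AddCommMonoid M.Num where
  add_assoc := num_add_assoc
  zero_add := num_zero_add
  add_zero := M.isACA0.add_zero
  add_comm := num_add_comm
  nsmul := nsmulRec

theorem num_zero_mul (a : M.Num) : 0 * a = 0 := by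
  induction a using arith_induction with
  | hP => infer_instance
  | zero => exact M.isACA0.mul_zero 0
  | succ a ih => rw [M.isACA0.mul_add_one, ih, add_zero]

theorem num_add_one_mul (a b : M.Num) : (a + 1) * b = a * b + b := by
  induction b using arith_induction with
  | hP => infer_instance
  | zero => rw [M.isACA0.mul_zero, M.isACA0.mul_zero, add_zero]
  | succ b ih =>
    rw [M.isACA0.mul_add_one, ih, M.isACA0.mul_add_one]
    ac_rfl

theorem num_mul_comm (a b : M.Num) : a * b = b * a := by
  induction b using arith_induction with
  | hP => infer_instance
  | zero => rw [M.isACA0.mul_zero, num_zero_mul]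
  | succ b ih => rw [M.isACA0.mul_add_one, ih, num_add_one_mul]

theorem num_mul_add (a b c : M.Num) : a * (b + c) = a * b + a * c := by
  induction c using arith_induction with
  | hP => infer_instance
  | zero => rw [add_zero, M.isACA0.mul_zero, add_zero]
  | succ c ih => rw [← add_assoc, M.isACA0.mul_add_one, ih, M.isACA0.mul_add_one, add_assoc]

theorem num_mul_assoc (a b c : M.Num) : a * b * c = a * (b * c) := by
  induction c using arith_induction with
  | hP => infer_instance
  | zero => simp only [M.isACA0.mul_zero]
  | succ c ih => rw [M.isACA0.mul_add_one, ih, M.isACA0.mul_add_one, num_mul_add]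

theorem num_mul_one (a : M.Num) : a * 1 = a := by
  rw [← zero_add (1 : M.Num), M.isACA0.mul_add_one, M.isACA0.mul_zero, zero_add]

instance : CommSemiring M.Num where
  mul_comm := num_mul_comm
  mul_assoc := num_mul_assoc
  mul_one := num_mul_one
  one_mul a := by rw [num_mul_comm, num_mul_one]
  zero_mul := num_zero_mul
  mul_zero := M.isACA0.mul_zero
  left_distrib := num_mul_add
  right_distrib a b c := by rw [num_mul_comm, num_mul_add, num_mul_comm a, num_mul_comm b]
  nsmul := nsmulRec
  npow := npowRec

theorem num_lt_iff {a b : M.Num} : a < b ↔ ∃ c, a + c + 1 = b := by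
  induction b using arith_induction with
  | hP => infer_instance
  | zero => simp [M.isACA0.not_lt_zero, M.isACA0.add_one_ne_zero]
  | succ b ih =>
    rw [M.isACA0.lt_add_one_iff, ih]
    constructor
    · rintro (⟨c, rfl⟩ | rfl)
      · exact ⟨c + 1, by ring⟩
      · exact ⟨0, by ring⟩
    · rintro ⟨c, hc⟩
      obtain rfl := M.isACA0.add_one_inj _ _ hc
      induction c using arith_induction with
      | hP => infer_instance
      | zero => right; ring
      | succ c _ => exact Or.inl ⟨c, by ring⟩

theorem num_eq_zero_or (a : M.Num) : a = 0 ∨ ∃ b, a = b + 1 := by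
  induction a using arith_induction with
  | hP => infer_instance
  | zero => exact Or.inl rfl
  | succ a _ => exact Or.inr ⟨a, rfl⟩

theorem num_add_right_cancel (a b c : M.Num) (h : a + c = b + c) : a = b := by
  induction c using arith_induction with
  | hP => infer_instance
  | zero => simpa using h
  | succ c ih =>
    rw [← add_assoc, ← add_assoc] at h
    exact ih (M.isACA0.add_one_inj _ _ h)

theorem num_lt_irrefl (a : M.Num) : ¬ a < a := by
  rw [num_lt_iff]
  rintro ⟨c, hc⟩
  refine M.isACA0.add_one_ne_zero c (num_add_right_cancel _ _ a ?_)
  rw [zero_add]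
  nth_rewrite 2 [← hc]
  ring

theorem num_lt_trans (a b c : M.Num) (hab : a < b) (hbc : b < c) : a < c := by
  rw [num_lt_iff] at *
  obtain ⟨d, rfl⟩ := hab
  obtain ⟨e, rfl⟩ := hbc
  exact ⟨d + e + 1, by ring⟩

theorem num_lt_trichotomy (a b : M.Num) : a < b ∨ a = b ∨ b < a := by
  induction b using arith_induction with
  | hP => infer_instance
  | zero =>
    obtain rfl | ⟨c, rfl⟩ := num_eq_zero_or a
    · exact Or.inr (Or.inl rfl)
    · exact Or.inr (Or.inr (num_lt_iff.2 ⟨c, by ring⟩))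
  | succ b ih =>
    rcases ih with h | rfl | h
    · exact Or.inl ((M.isACA0.lt_add_one_iff _ _).2 (Or.inl h))
    · exact Or.inl ((M.isACA0.lt_add_one_iff _ _).2 (Or.inr rfl))
    · obtain ⟨c, rfl⟩ := num_lt_iff.1 h
      obtain rfl | ⟨d, rfl⟩ := num_eq_zero_or c
      · exact Or.inr (Or.inl (by ring))
      · exact Or.inr (Or.inr (num_lt_iff.2 ⟨d, by ring⟩))

noncomputable instance : LinearOrder M.Num where
  le a b := a < b ∨ a = b
  le_refl _ := Or.inr rfl
  le_trans a b c := by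
    rintro (hab | rfl) (hbc | rfl)
    · exact Or.inl (num_lt_trans _ _ _ hab hbc)
    · exact Or.inl hab
    · exact Or.inl hbc
    · exact Or.inr rfl
  lt_iff_le_not_ge a b := by
    constructor
    · intro h
      refine ⟨Or.inl h, ?_⟩
      rintro (h' | rfl)
      · exact num_lt_irrefl _ (num_lt_trans _ _ _ h h')
      · exact num_lt_irrefl _ h
    · rintro ⟨h | rfl, h'⟩
      · exact h
      · exact absurd (Or.inr rfl) h'
  le_antisymm a b := by
    rintro (h | rfl) (h' | h')
    · exact absurd (num_lt_trans _ _ _ h h') (num_lt_irrefl _)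
    · exact h'.symm
    · rfl
    · rfl
  le_total a b := by
    rcases num_lt_trichotomy a b with h | h | h
    · exact Or.inl (Or.inl h)
    · exact Or.inl (Or.inr h)
    · exact Or.inr (Or.inl h)
  toDecidableLE := Classical.decRel _

instance : CanonicallyOrderedAdd M.Num where
  exists_add_of_le := by
    rintro a b (h | rfl)
    · obtain ⟨c, rfl⟩ := num_lt_iff.1 h
      exact ⟨c + 1, by ring⟩
    · exact ⟨0, by ring⟩
  le_self_add a b := by
    obtain rfl | ⟨c, rfl⟩ := num_eq_zero_or b
    · exact Or.inr (by ring)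
    · exact Or.inl (num_lt_iff.2 ⟨c, by ring⟩)
  le_add_self a b := by
    obtain rfl | ⟨c, rfl⟩ := num_eq_zero_or b
    · exact Or.inr (by ring)
    · exact Or.inl (num_lt_iff.2 ⟨c, by ring⟩)

instance : IsCancelAdd M.Num :=
  have : IsRightCancelAdd M.Num := ⟨fun a b c h => num_add_right_cancel b c a h⟩
  AddCommMagma.IsRightCancelAdd.toIsCancelAdd M.Num

theorem num_lt_add_one_iff {a b : M.Num} : a < b + 1 ↔ a ≤ b :=
  M.isACA0.lt_add_one_iff a b

instance : IsStrictOrderedRing M.Num := by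
  have hadd : ∀ a b : M.Num, a ≤ b → ∀ c, c + a ≤ c + b := fun a b h c => by
    obtain ⟨d, rfl⟩ := exists_add_of_le h
    rw [← add_assoc]
    exact le_self_add
  exact
  { add_le_add_left := fun a b h c => by simpa only [add_comm _ c] using hadd a b h c
    le_of_add_le_add_left := fun a b c h => by
      by_contra hlt
      have h1 := hadd _ _ (le_of_not_ge hlt) a
      exact hlt (add_left_cancel (le_antisymm h h1)).le
    exists_pair_ne := ⟨0, 1, fun h => M.isACA0.add_one_ne_zero 0 (by rw [zero_add, ← h])⟩
    zero_le_one := zero_le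
    mul_lt_mul_of_pos_left := fun a ha b c h => by
      obtain ⟨d, rfl⟩ := num_lt_iff.1 h
      obtain ⟨e, rfl⟩ := num_lt_iff.1 ha
      exact num_lt_iff.2 ⟨d + (e * d) + e, by ring⟩
    mul_lt_mul_of_pos_right := fun a ha b c h => by
      obtain ⟨d, rfl⟩ := num_lt_iff.1 h
      obtain ⟨e, rfl⟩ := num_lt_iff.1 ha
      exact num_lt_iff.2 ⟨d + (e * d) + e, by ring⟩ }

instance Arith.le {n : ℕ} {f g : (Fin n → M.Num) → M.Num} [ArithFun f] [ArithFun g] :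
    Arith fun v => f v ≤ g v :=
  Arith.congr (P := fun v => f v < g v ∨ f v = g v) inferInstance fun _ => le_iff_lt_or_eq

instance Arith.dvd {n : ℕ} {f g : (Fin n → M.Num) → M.Num} [ArithFun f] [hg : ArithFun g] :
    Arith fun v => f v ∣ g v := by
  have := (inferInstance : ArithFun f).weaken
  have := hg.weaken
  exact Arith.congr (P := fun v => ∃ z, g v = f v * z) inferInstance fun _ => Iff.rfl

theorem arith_strong_induction {P : M.Num → Prop} (n : M.Num)
    (hP : Arith fun v : Fin 1 → M.Num => P (v 0)) (h : ∀ n, (∀ m < n, P m) → P n) : P n := by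
  have hP' {n : ℕ} (f : (Fin n → M.Num) → M.Num) [hf : ArithFun f] : Arith fun v => P (f v) :=
    hP.comp₁ hf
  have key : ∀ m < n, P m := by
    induction n using arith_induction with
    | hP => infer_instance
    | zero => exact fun m hm => absurd hm (M.isACA0.not_lt_zero m)
    | succ n ih =>
      intro m hm
      rcases (M.isACA0.lt_add_one_iff m n).1 hm with hm | rfl
      · exact ih m hm
      · exact h _ ih
  exact h n key

theorem exists_least {P : M.Num → Prop} (hP : Arith fun v : Fin 1 → M.Num => P (v 0))
    (h : ∃ n, P n) : ∃ n, P n ∧ ∀ m < n, ¬ P m := by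
  by_contra hno
  push Not at hno
  obtain ⟨n, hn⟩ := h
  refine (?_ : ¬ P n) hn
  induction n using arith_strong_induction with
  | hP => infer_instance
  | h n ih =>
    intro hn
    obtain ⟨m, hm, hPm⟩ := hno n hn
    exact ih m hm hPm hPm

theorem pair_lt_pair {i j k l : M.Num} (h : i + j < k + l) : pair i j < pair k l := by
  have h1 : i + j + 1 ≤ k + l := by
    obtain ⟨c, hc⟩ := num_lt_iff.1 h
    rw [← hc]
    exact add_le_add_left (le_self_add (a := i + j) (b := c)) 1
  calc pair i j < (i + j + 1) * (i + j + 1) := num_lt_iff.2 ⟨i + j + j, by unfold pair; ring⟩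
    _ ≤ (k + l) * (k + l) := by gcongr
    _ ≤ pair k l := le_self_add (a := (k + l) * (k + l))

theorem pair_inj {i j k l : M.Num} : pair i j = pair k l ↔ i = k ∧ j = l := by
  refine ⟨fun h => ?_, by rintro ⟨rfl, rfl⟩; rfl⟩
  rcases lt_trichotomy (i + j) (k + l) with h' | h' | h'
  · exact absurd h (pair_lt_pair h').ne
  · obtain rfl : i = k := by
      unfold pair at h
      rw [h'] at h
      exact add_left_cancel h
    exact ⟨rfl, add_left_cancel h'⟩
  · exact absurd h (pair_lt_pair h').ne'

theorem snoc_inj {s m t n : M.Num} : snoc s m = snoc t n ↔ s = t ∧ m = n := by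
  rw [snoc, snoc, add_left_inj, pair_inj]

theorem zero_ne_snoc (s m : M.Num) : 0 ≠ snoc s m := (M.isACA0.add_one_ne_zero _).symm

theorem le_mul_self (a : M.Num) : a ≤ a * a := by
  rcases num_eq_zero_or a with rfl | ⟨b, rfl⟩
  · simp
  · exact le_mul_of_one_le_left (zero_le) le_add_self

theorem lt_snoc (s m : M.Num) : s < snoc s m :=
  num_lt_add_one_iff.2 (calc
    s ≤ s + m := le_self_add
    _ ≤ (s + m) * (s + m) := le_mul_self _
    _ ≤ pair s m := le_self_add (a := (s + m) * (s + m)))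

/-! ### Codes of finite sets and recursion -/

theorem num_dvd_of_dvd_add {a b x : M.Num} (hab : x ∣ a + b) (ha : x ∣ a) : x ∣ b := by
  obtain ⟨u, rfl⟩ := ha
  obtain ⟨v, hv⟩ := hab
  rcases le_total u v with h | h
  · obtain ⟨t, rfl⟩ := exists_add_of_le h
    exact ⟨t, add_left_cancel (hv.trans (mul_add x u t))⟩
  · obtain ⟨t, rfl⟩ := exists_add_of_le h
    rw [mul_add, add_assoc] at hv
    have h0 : x * t + b = 0 := add_left_cancel (hv.trans (add_zero _).symm)
    rw [(add_eq_zero.1 h0).2]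
    exact dvd_zero x

/-- The set `{i < b | 1 + (i + 1) w ∣ e}` with the code `c = (b, (w, e))`. -/
def decode (c : M.Num) : Set M.Num :=
  {i | ∃ b w e, c = pair b (pair w e) ∧ i < b ∧ 1 + (i + 1) * w ∣ e}

instance Arith.mem_decode {n : ℕ} {f g : (Fin n → M.Num) → M.Num} [hf : ArithFun f]
    [hg : ArithFun g] : Arith fun v => f v ∈ decode (g v) :=
  Arith.comp₂ (P := fun x y => x ∈ decode y) (by
    change Arith fun v : Fin 2 → M.Num =>
      ∃ b w e, v 1 = pair b (pair w e) ∧ v 0 < b ∧ 1 + (v 0 + 1) * w ∣ e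
    infer_instance) hf hg

theorem mem_decode_pair {b w e i : M.Num} :
    i ∈ decode (pair b (pair w e)) ↔ i < b ∧ 1 + (i + 1) * w ∣ e := by
  constructor
  · rintro ⟨b', w', e', h, hi⟩
    obtain ⟨rfl, h'⟩ := pair_inj.1 h
    obtain ⟨rfl, rfl⟩ := pair_inj.1 h'
    exact hi
  · exact fun h => ⟨b, w, e, rfl, h⟩

theorem decode_bounded (c : M.Num) : ∃ b, ∀ i ∈ decode c, i < b := by
  by_cases h : ∃ b w e, c = pair b (pair w e)
  · obtain ⟨b, w, e, rfl⟩ := h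
    exact ⟨b, fun i hi => (mem_decode_pair.1 hi).1⟩
  · exact ⟨0, fun i ⟨b, w, e, hc, _⟩ => absurd ⟨b, w, e, hc⟩ h⟩

theorem exists_common_multiple (b : M.Num) : ∃ w, 0 < w ∧ ∀ t, 0 < t → t ≤ b → t ∣ w := by
  induction b using arith_induction with
  | hP => infer_instance
  | zero => exact ⟨1, zero_lt_one, fun t ht ht' => absurd ht' ht.not_ge⟩
  | succ b ih =>
    obtain ⟨w, hw, h⟩ := ih
    refine ⟨w * (b + 1), mul_pos hw (num_lt_add_one_iff.2 zero_le), fun t ht htb => ?_⟩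
    rcases htb.lt_or_eq with htb | rfl
    · exact (h t ht (num_lt_add_one_iff.1 htb)).mul_right _
    · exact dvd_mul_left _ _

/-- If `w` is a multiple of `|i - j|`, then the moduli `1 + (i + 1) w` and `1 + (j + 1) w` are
coprime: `(j + 1) (1 + (i + 1) w) - (i + 1) (1 + (j + 1) w) = j - i` divides `w`. -/
theorem dvd_of_dvd_modulus_mul {b w i j z : M.Num} (hw : ∀ t, 0 < t → t ≤ b → t ∣ w) (hi : i < b)
    (hj : j < b) (hij : i ≠ j) (h : 1 + (j + 1) * w ∣ (1 + (i + 1) * w) * z) :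
    1 + (j + 1) * w ∣ z := by
  suffices ∃ t, t ∣ w ∧ 1 + (j + 1) * w ∣ t * z by
    obtain ⟨t, ⟨s, rfl⟩, ht⟩ := this
    refine num_dvd_of_dvd_add (a := (j + 1) * (t * s) * z) ?_ ?_
    · exact ⟨z, by ring⟩
    · exact (ht.mul_left ((j + 1) * s)).trans (dvd_of_eq (by ring))
  rcases lt_or_gt_of_ne hij with hlt | hlt
  · obtain ⟨t, rfl⟩ := exists_add_of_le hlt.le
    have ht : 0 < t := pos_of_lt_add_right hlt
    refine ⟨t, hw t ht (le_add_self.trans hj.le), ?_⟩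
    refine num_dvd_of_dvd_add (a := (i + 1) * ((1 + (i + t + 1) * w) * z)) ?_ ?_
    · exact (h.mul_left (i + t + 1)).trans (dvd_of_eq (by ring))
    · exact (dvd_mul_right _ _).mul_left _
  · obtain ⟨t, rfl⟩ := exists_add_of_le hlt.le
    have ht : 0 < t := pos_of_lt_add_right hlt
    refine ⟨t, hw t ht (le_add_self.trans hi.le), ?_⟩
    refine num_dvd_of_dvd_add (a := (j + 1) * ((1 + (j + t + 1) * w) * z)) ?_ ?_
    · exact ((dvd_mul_right _ z).mul_left (j + t + 1)).trans (dvd_of_eq (by ring))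
    · exact h.mul_left _

/-- The code of `A ∩ [0, b)` is the product of the moduli that belong to its elements. -/
theorem exists_decode_eq {A : Set M.Num} (hA : A ∈ M.sets) (b : M.Num) :
    ∃ c, ∀ i, i ∈ decode c ↔ i < b ∧ i ∈ A := by
  have : Fact (A ∈ M.sets) := ⟨hA⟩
  obtain ⟨w, hw0, hw⟩ := exists_common_multiple b
  have key (n : M.Num) : n ≤ b → ∃ e, ∀ j, j < b → (1 + (j + 1) * w ∣ e ↔ j ∈ A ∧ j < n) := by
    induction n using arith_induction with
    | hP => infer_instance
    | zero =>
      refine fun _ => ⟨1, fun j _ =>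
        ⟨fun ⟨z, hz⟩ => ?_, fun h => absurd h.2 (M.isACA0.not_lt_zero j)⟩⟩
      have h0 : (j + 1) * w * z ≠ 0 := by
        rintro h0
        rcases mul_eq_zero.1 h0 with h | rfl
        · exact (mul_pos (num_lt_add_one_iff.2 zero_le) hw0).ne' h
        · simp at hz
      have h1 : z ≠ 0 := by rintro rfl; simp at h0
      obtain ⟨y, rfl⟩ := (num_eq_zero_or z).resolve_left h1
      refine absurd ?_ h0
      have h2 : y + (j + 1) * w * (y + 1) = 0 := by
        refine add_left_cancel (a := (1 : M.Num)) ?_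
        rw [add_zero]
        exact Eq.trans (by ring) hz.symm
      exact (add_eq_zero.1 h2).2
    | succ n ih =>
      intro hn
      have hnb : n < b := (num_lt_add_one_iff.2 le_rfl).trans_le hn
      obtain ⟨e, he⟩ := ih hnb.le
      by_cases hnA : n ∈ A
      · refine ⟨(1 + (n + 1) * w) * e, fun j hj => ?_⟩
        rw [M.isACA0.lt_add_one_iff]
        by_cases hjn : j = n
        · subst hjn
          simp [hnA]
        · rw [or_iff_left hjn, ← he j hj]
          exact ⟨dvd_of_dvd_modulus_mul hw hnb hj (Ne.symm hjn), fun h => h.mul_left _⟩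
      · refine ⟨e, fun j hj => ?_⟩
        rw [he j hj, M.isACA0.lt_add_one_iff]
        refine and_congr_right fun hjA => (or_iff_left ?_).symm
        rintro rfl
        exact hnA hjA
  obtain ⟨e, he⟩ := key b le_rfl
  refine ⟨pair b (pair w e), fun i => ?_⟩
  rw [mem_decode_pair]
  refine and_congr_right fun hi => ?_
  rw [he i hi, and_iff_left hi]

theorem exists_decode_eq_of_bounded {A : Set M.Num} (hA : A ∈ M.sets) (hb : ∃ b, ∀ i ∈ A, i < b) :
    ∃ c, decode c = A := by
  obtain ⟨b, hb⟩ := hb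
  obtain ⟨c, hc⟩ := exists_decode_eq hA b
  exact ⟨c, Set.ext fun i => (hc i).trans (and_iff_right_of_imp (hb i))⟩

theorem decode_zero : decode (0 : M.Num) = ∅ := by
  have h : (0 : M.Num) = pair 0 (pair 0 0) := by simp [pair]
  ext i
  rw [h, mem_decode_pair]
  simp [M.isACA0.not_lt_zero]

/-- Course-of-values recursion: there is a set of the model that consists of the numbers in `B` and
of those that are reached from smaller elements by a step of `E`. Its initial segments are
finite and thus have codes, and quantification over the codes gives an arithmetical definition. -/
theorem exists_recursive_set (B : M.Num → Prop) (E : M.Num → M.Num → Prop)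
    [hB : Arith fun v : Fin 1 → M.Num => B (v 0)]
    [hE : Arith fun v : Fin 2 → M.Num => E (v 0) (v 1)] :
    ∃ T ∈ M.sets, ∀ s, s ∈ T ↔ B s ∨ ∃ t, t < s ∧ t ∈ T ∧ E t s := by
  have iB {n : ℕ} (f : (Fin n → M.Num) → M.Num) [hf : ArithFun f] : Arith fun v => B (f v) :=
    hB.comp₁ hf
  have iE {n : ℕ} (f g : (Fin n → M.Num) → M.Num) [hf : ArithFun f] [hg : ArithFun g] :
    Arith fun v => E (f v) (g v) := hE.comp₂ hf hg
  -- `Good c n`: the set with the code `c` satisfies the recursion below `n`.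
  obtain ⟨Good, hGood⟩ : ∃ Good : M.Num → M.Num → Prop, Good = fun c n =>
    ∀ s, s < n → (s ∈ decode c ↔ B s ∨ ∃ t, t < s ∧ t ∈ decode c ∧ E t s) := ⟨_, rfl⟩
  have good_iff {c n : M.Num} : Good c n ↔
      ∀ s, s < n → (s ∈ decode c ↔ B s ∨ ∃ t, t < s ∧ t ∈ decode c ∧ E t s) := by rw [hGood]
  have iGood {n : ℕ} (f g : (Fin n → M.Num) → M.Num) [hf : ArithFun f] [hg : ArithFun g] :
      Arith fun v => Good (f v) (g v) :=
    Arith.comp₂ (P := Good) (by rw [hGood]; infer_instance) hf hg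
  have good_unique {c c' n : M.Num} (hc : Good c n) (hc' : Good c' n) (s : M.Num) :
      s < n → (s ∈ decode c ↔ s ∈ decode c') := by
    induction s using arith_strong_induction with
    | hP => infer_instance
    | h s ih =>
      intro hs
      rw [good_iff.1 hc s hs, good_iff.1 hc' s hs]
      exact or_congr_right (exists_congr fun t => and_congr_right fun ht =>
        and_congr_left fun _ => ih t ht (ht.trans hs))
  have exists_good (n : M.Num) : ∃ c, Good c n := by
    induction n using arith_induction with
    | hP => infer_instance
    | zero => exact ⟨0, good_iff.2 fun s hs => absurd hs (M.isACA0.not_lt_zero s)⟩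
    | succ n ih =>
      obtain ⟨c, hc⟩ := ih
      obtain ⟨c', hc'⟩ := exists_decode_eq (mem_sets_of_arith (P := fun s =>
        s < n ∧ s ∈ decode c ∨ s = n ∧ (B n ∨ ∃ t, t < n ∧ t ∈ decode c ∧ E t n))) (n + 1)
      have hlt {s : M.Num} (hs : s < n) : s ∈ decode c' ↔ s ∈ decode c := by
        rw [hc' s]
        simp [hs, hs.ne, hs.trans (num_lt_add_one_iff.2 le_rfl)]
      refine ⟨c', good_iff.2 fun s hs => ?_⟩
      have hrec : (∃ t, t < s ∧ t ∈ decode c' ∧ E t s) ↔ ∃ t, t < s ∧ t ∈ decode c ∧ E t s :=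
        exists_congr fun t => and_congr_right fun ht => and_congr_left fun _ =>
          hlt (ht.trans_le (num_lt_add_one_iff.1 hs))
      rw [hrec]
      rcases (M.isACA0.lt_add_one_iff s n).1 hs with hs | rfl
      · rw [hlt hs, good_iff.1 hc s hs]
      · rw [hc']
        simp [hs]
  have good_mono {c n m : M.Num} (hc : Good c n) (hm : m ≤ n) : Good c m :=
    good_iff.2 fun s hs => good_iff.1 hc s (hs.trans_le hm)
  have hT {c s : M.Num} (hc : Good c (s + 1)) {t : M.Num} (ht : t ≤ s) :
      (∃ c, Good c (t + 1) ∧ t ∈ decode c) ↔ t ∈ decode c := by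
    have hct : Good c (t + 1) := good_mono hc (add_le_add_left ht 1)
    exact ⟨fun ⟨c', hc', h⟩ => (good_unique hc' hct t (num_lt_add_one_iff.2 le_rfl)).1 h,
      fun h => ⟨c, hct, h⟩⟩
  refine ⟨_, mem_sets_of_arith (P := fun s => ∃ c, Good c (s + 1) ∧ s ∈ decode c), fun s => ?_⟩
  obtain ⟨c, hc⟩ := exists_good (s + 1)
  rw [Set.mem_ofPred_eq, hT hc le_rfl, good_iff.1 hc s (num_lt_add_one_iff.2 le_rfl)]
  exact or_congr_right (exists_congr fun t => and_congr_right fun ht =>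
    and_congr_left fun _ => (hT hc ht.le).symm)

/-! ### Arithmetical families -/

theorem mem_sets_of_arith₂ {P : M.Num → M.Num → Prop}
    [h : Arith fun v : Fin 2 → M.Num => P (v 0) (v 1)] :
    {n | ∃ i k, n = pair i k ∧ P i k} ∈ M.sets := by
  have iP {n : ℕ} (f g : (Fin n → M.Num) → M.Num) [hf : ArithFun f] [hg : ArithFun g] :
    Arith fun v => P (f v) (g v) := h.comp₂ hf hg
  exact mem_sets_of_arith (P := fun n => ∃ i k, n = pair i k ∧ P i k)

theorem mem_sets_of_arith₃ {P : M.Num → M.Num → M.Num → Prop}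
    [h : Arith fun v : Fin 3 → M.Num => P (v 0) (v 1) (v 2)] :
    {n | ∃ i k g, n = pair (pair i k) g ∧ P i k g} ∈ M.sets := by
  have iP {n : ℕ} (f g e : (Fin n → M.Num) → M.Num) [hf : ArithFun f] [hg : ArithFun g]
    [he : ArithFun e] : Arith fun v => P (f v) (g v) (e v) := h.comp₃ hf hg he
  exact mem_sets_of_arith (P := fun n => ∃ i k g, n = pair (pair i k) g ∧ P i k g)

namespace Family

/-- The number `g` belongs to the `k`-th finite set of the family. -/
def Mem (a : Family M) (k g : M.Num) : Prop := k ∈ a.idx ∧ g ∈ a.term k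

instance arith_idx (a : Family M) {n : ℕ} {f : (Fin n → M.Num) → M.Num} [ArithFun f] :
    Arith fun v => f v ∈ a.idx :=
  Arith.mem a.idx_mem

instance arith_mem (a : Family M) {n : ℕ} {f g : (Fin n → M.Num) → M.Num} [ArithFun f]
    [ArithFun g] : Arith fun v => a.Mem (f v) (g v) :=
  (Arith.mem a.term_mem (f := fun v => pair (f v) (g v))).congr fun v => by
    constructor
    · exact fun h => ⟨_, _, rfl, h⟩
    · rintro ⟨k, x, h, hk⟩
      obtain ⟨hk', hx'⟩ := pair_inj.1 h
      rw [hk', hx']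
      exact hk

instance arith_seq_idx {s : M.Num → Family M} [hs : Fact (IsFamilySeq s)] {n : ℕ}
    {i f : (Fin n → M.Num) → M.Num} [ArithFun i] [ArithFun f] :
    Arith fun v => f v ∈ (s (i v)).idx :=
  (Arith.mem hs.out.1 (f := fun v => pair (i v) (f v))).congr fun v => by
    constructor
    · exact fun h => ⟨_, _, rfl, h⟩
    · rintro ⟨k, x, h, hk⟩
      obtain ⟨hk', hx'⟩ := pair_inj.1 h
      rw [hk', hx']
      exact hk

instance arith_seq_mem {s : M.Num → Family M} [hs : Fact (IsFamilySeq s)] {n : ℕ}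
    {i f g : (Fin n → M.Num) → M.Num} [ArithFun i] [ArithFun f] [ArithFun g] :
    Arith fun v => (s (i v)).Mem (f v) (g v) :=
  (Arith.mem hs.out.2 (f := fun v => pair (pair (i v) (f v)) (g v))).congr fun v => by
    constructor
    · exact fun h => ⟨_, _, _, rfl, h⟩
    · rintro ⟨k, x, y, h, hk⟩
      obtain ⟨h', hy'⟩ := pair_inj.1 h
      obtain ⟨hk', hx'⟩ := pair_inj.1 h'
      rw [hk', hx', hy']
      exact hk

theorem isFamilySeq_of_arith {s : M.Num → Family M}
    (h₁ : Arith fun v : Fin 2 → M.Num => v 1 ∈ (s (v 0)).idx)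
    (h₂ : Arith fun v : Fin 3 → M.Num => (s (v 0)).Mem (v 1) (v 2)) : IsFamilySeq s :=
  ⟨mem_sets_of_arith₂ (P := fun i k => k ∈ (s i).idx),
    mem_sets_of_arith₃ (P := fun i k g => (s i).Mem k g)⟩

theorem isFamilySeq_const (a : Family M) : IsFamilySeq fun _ => a :=
  isFamilySeq_of_arith inferInstance inferInstance

theorem term_mem_members {a : Family M} {k : M.Num} (hk : k ∈ a.idx) : a.term k ∈ a.members :=
  ⟨k, hk, rfl⟩

theorem mem_term_iff {a : Family M} {k : M.Num} (hk : k ∈ a.idx) {g : M.Num} :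
    g ∈ a.term k ↔ a.Mem k g := (and_iff_right hk).symm

theorem mem_sets_of_mem_members {a : Family M} {p : Set M.Num} (hp : p ∈ a.members) :
    p ∈ M.sets := by
  obtain ⟨k, hk, rfl⟩ := hp
  have : a.term k = {g | a.Mem k g} := Set.ext fun g => mem_term_iff hk
  rw [this]
  exact mem_sets_of_arith (P := fun g => a.Mem k g)

theorem exists_decode_eq_of_mem_members {a : Family M} {p : Set M.Num} (hp : p ∈ a.members) :
    ∃ c, decode c = p := by
  refine exists_decode_eq_of_bounded (mem_sets_of_mem_members hp) ?_
  obtain ⟨k, hk, rfl⟩ := hp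
  exact a.bounded k hk

theorem mem_openSet_iff {a : Family M} {x : Set M.Num} (hx : x ∈ M.sets) :
    x ∈ a.openSet ↔ ∃ k, k ∈ a.idx ∧ ∀ g, a.Mem k g → g ∈ x := by
  constructor
  · rintro ⟨_, p, ⟨k, hk, rfl⟩, hp⟩
    exact ⟨k, hk, fun g hg => hp hg.2⟩
  · rintro ⟨k, hk, h⟩
    exact ⟨hx, _, term_mem_members hk, fun g hg => h g ⟨hk, hg⟩⟩

theorem Same.openSet_eq {a b : Family M} (h : a.Same b) : a.openSet = b.openSet := by
  unfold openSet
  rw [show a.members = b.members from h]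

theorem Le.openSet_subset {a b : Family M} (h : a.Le b) : a.openSet ⊆ b.openSet := by
  rintro x ⟨hx, p, hp, hpx⟩
  obtain ⟨q, hq, hqp⟩ := h p hp
  exact ⟨hx, q, hq, hqp.trans hpx⟩

theorem IsInf.openSet_eq {a b c : Family M} (h : c.IsInf a b) :
    c.openSet = a.openSet ∩ b.openSet := by
  ext x
  constructor
  · rintro ⟨hx, r, hr, hrx⟩
    rw [show c.members = _ from h] at hr
    obtain ⟨p, hp, q, hq, rfl⟩ := hr
    exact ⟨⟨hx, p, hp, Set.subset_union_left.trans hrx⟩,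
      ⟨hx, q, hq, Set.subset_union_right.trans hrx⟩⟩
  · rintro ⟨⟨hx, p, hp, hpx⟩, ⟨_, q, hq, hqx⟩⟩
    refine ⟨hx, p ∪ q, ?_, Set.union_subset hpx hqx⟩
    rw [show c.members = _ from h]
    exact ⟨p, hp, q, hq, rfl⟩

theorem IsSup.openSet_eq {c : Family M} {s : M.Num → Family M} (h : c.IsSup s) :
    c.openSet = ⋃ i, (s i).openSet := by
  ext x
  rw [Set.mem_iUnion]
  constructor
  · rintro ⟨hx, r, hr, hrx⟩
    rw [show c.members = _ from h] at hr
    obtain ⟨i, hr⟩ := hr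
    exact ⟨i, hx, r, hr, hrx⟩
  · rintro ⟨i, hx, r, hr, hrx⟩
    refine ⟨hx, r, ?_, hrx⟩
    rw [show c.members = _ from h]
    exact ⟨i, hr⟩

theorem IsMeetOf.mem_openSet_iff {a : Family M} {p : Set M.Num} (h : a.IsMeetOf p) {x : Set M.Num} :
    x ∈ a.openSet ↔ x ∈ M.sets ∧ p ⊆ x := by
  unfold openSet
  rw [show a.members = _ from h]
  simp

/-- The family of the finite sets `{g | R k g}` for the numbers `k` with `I k`. -/
def ofArith (I : M.Num → Prop) (R : M.Num → M.Num → Prop)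
    (hI : Arith fun v : Fin 1 → M.Num => I (v 0))
    (hR : Arith fun v : Fin 2 → M.Num => R (v 0) (v 1))
    (hb : ∀ k, I k → ∃ b, ∀ g, R k g → g < b) : Family M where
  idx := {k | I k}
  term k := {g | R k g}
  idx_mem := mem_sets_of_arith
  term_mem :=
    have : Arith fun v : Fin 2 → M.Num => I (v 0) := Arith.comp₁ hI inferInstance
    mem_sets_of_arith₂ (P := fun k g => I k ∧ R k g)
  bounded := hb

/-- The finite meet of the generators in the finite set with the code `c`. -/
def single (c : M.Num) : Family M :=
  ofArith (fun k => k = 0) (fun _ g => g ∈ decode c) inferInstance inferInstance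
    fun _ _ => decode_bounded c

theorem single_isMeetOf (c : M.Num) : (single c).IsMeetOf (decode c) := by
  ext p
  constructor
  · rintro ⟨k, _, rfl⟩
    rfl
  · rintro rfl
    exact ⟨0, rfl, rfl⟩

theorem exists_isInf (a b : Family M) : ∃ c : Family M, c.IsInf a b := by
  refine ⟨ofArith (fun n => ∃ i j, n = pair i j ∧ i ∈ a.idx ∧ j ∈ b.idx)
    (fun n g => ∃ i j, n = pair i j ∧ (a.Mem i g ∨ b.Mem j g)) inferInstance inferInstance ?_, ?_⟩
  · rintro _ ⟨i, j, rfl, hi, hj⟩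
    obtain ⟨d, hd⟩ := a.bounded i hi
    obtain ⟨e, he⟩ := b.bounded j hj
    refine ⟨max d e, ?_⟩
    rintro g ⟨i', j', h, hg⟩
    obtain ⟨rfl, rfl⟩ := pair_inj.1 h
    exact lt_max_iff.2 (hg.imp (fun h => hd g h.2) fun h => he g h.2)
  · have hterm {i j : M.Num} (hi : i ∈ a.idx) (hj : j ∈ b.idx) :
        {g | ∃ i' j', pair i j = pair i' j' ∧ (a.Mem i' g ∨ b.Mem j' g)} = a.term i ∪ b.term j := by
      ext g
      rw [Set.mem_union, mem_term_iff hi, mem_term_iff hj]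
      constructor
      · rintro ⟨i', j', h, hg⟩
        obtain ⟨rfl, rfl⟩ := pair_inj.1 h
        exact hg
      · exact fun hg => ⟨i, j, rfl, hg⟩
    ext r
    constructor
    · rintro ⟨_, ⟨i, j, rfl, hi, hj⟩, rfl⟩
      exact ⟨_, term_mem_members hi, _, term_mem_members hj, hterm hi hj⟩
    · rintro ⟨_, ⟨i, hi, rfl⟩, _, ⟨j, hj, rfl⟩, rfl⟩
      exact ⟨pair i j, ⟨i, j, rfl, hi, hj⟩, (hterm hi hj).symm⟩

theorem exists_isSup {s : M.Num → Family M} (hs : IsFamilySeq s) : ∃ c : Family M, c.IsSup s := by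
  have := Fact.mk hs
  have hterm {i k : M.Num} (hk : k ∈ (s i).idx) :
      {g | ∃ i' k', pair i k = pair i' k' ∧ (s i').Mem k' g} = (s i).term k := by
    ext g
    rw [mem_term_iff hk]
    constructor
    · rintro ⟨i', j', h, hg⟩
      obtain ⟨rfl, rfl⟩ := pair_inj.1 h
      exact hg
    · exact fun hg => ⟨i, k, rfl, hg⟩
  refine ⟨ofArith (fun n => ∃ i k, n = pair i k ∧ k ∈ (s i).idx)
    (fun n g => ∃ i k, n = pair i k ∧ (s i).Mem k g) inferInstance inferInstance ?_, ?_⟩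
  · rintro _ ⟨i, k, rfl, hk⟩
    obtain ⟨d, hd⟩ := (s i).bounded k hk
    exact ⟨d, fun g hg => hd g ((hterm hk).subset hg)⟩
  · ext r
    constructor
    · rintro ⟨_, ⟨i, k, rfl, hk⟩, rfl⟩
      exact ⟨i, k, hk, hterm hk⟩
    · rintro ⟨i, k, hk, rfl⟩
      exact ⟨pair i k, ⟨i, k, rfl, hk⟩, (hterm hk).symm⟩

open Classical in
/-- The two sequences `s` and `t` in one: the indices `(0, j)` and `(1, j)` stand for `s j` and
`t j`. The values at all other indices are irrelevant. -/
noncomputable def sumSeq (s t : M.Num → Family M) (i : M.Num) : Family M :=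
  if h : ∃ j, i = pair 0 j then s h.choose
  else if h : ∃ j, i = pair 1 j then t h.choose else s 0

theorem sumSeq_left (s t : M.Num → Family M) (j : M.Num) : sumSeq s t (pair 0 j) = s j := by
  have h : ∃ j', pair 0 j = pair 0 j' := ⟨j, rfl⟩
  rw [sumSeq, dif_pos h, ← (pair_inj.1 h.choose_spec).2]

theorem sumSeq_right (s t : M.Num → Family M) (j : M.Num) : sumSeq s t (pair 1 j) = t j := by
  have h0 : ¬ ∃ j', pair 1 j = pair 0 j' := fun ⟨j', h⟩ => one_ne_zero (pair_inj.1 h).1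
  have h : ∃ j', pair 1 j = pair 1 j' := ⟨j, rfl⟩
  rw [sumSeq, dif_neg h0, dif_pos h, ← (pair_inj.1 h.choose_spec).2]

theorem sumSeq_iff (s t : M.Num → Family M) (P : Family M → Prop) (i : M.Num) :
    P (sumSeq s t i) ↔ (∃ j, i = pair 0 j ∧ P (s j)) ∨ (∃ j, i = pair 1 j ∧ P (t j)) ∨
      ((¬ ∃ j, i = pair 0 j) ∧ (¬ ∃ j, i = pair 1 j)) ∧ P (s 0) := by
  by_cases h0 : ∃ j, i = pair 0 j
  · obtain ⟨j, rfl⟩ := h0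
    simp [sumSeq_left, pair_inj]
  · by_cases h1 : ∃ j, i = pair 1 j
    · obtain ⟨j, rfl⟩ := h1
      simp [sumSeq_right, pair_inj]
    · rw [sumSeq, dif_neg h0, dif_neg h1]
      push Not at h0 h1
      simp [h0, h1]

theorem isFamilySeq_sumSeq {s t : M.Num → Family M} (hs : IsFamilySeq s) (ht : IsFamilySeq t) :
    IsFamilySeq (sumSeq s t) := by
  have := Fact.mk hs
  have := Fact.mk ht
  exact isFamilySeq_of_arith
    (Arith.congr inferInstance fun v => sumSeq_iff s t (fun a => v 1 ∈ a.idx) (v 0))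
    (Arith.congr inferInstance fun v => sumSeq_iff s t (fun a => a.Mem (v 1) (v 2)) (v 0))

/-- For a sequence `W` of expressions and a relation `Q`, the sequence of the expressions
`⋁ (D ∧ W w)`, where the join for the index `s` is over all `c` and `w` with `Q s c w`, and where
`D` is the meet of the finite set with the code `c`. -/
def relSeq (Q : M.Num → M.Num → M.Num → Prop) (W : M.Num → Family M)
    (hQ : Arith fun v : Fin 3 → M.Num => Q (v 0) (v 1) (v 2)) (hW : IsFamilySeq W)
    (s : M.Num) : Family M :=
  have := Fact.mk hW
  have iQ {n : ℕ} (f g e : (Fin n → M.Num) → M.Num) [hf : ArithFun f] [hg : ArithFun g]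
    [he : ArithFun e] : Arith fun v => Q (f v) (g v) (e v) := hQ.comp₃ hf hg he
  ofArith (fun n => ∃ c w k, n = pair (pair c w) k ∧ Q s c w ∧ k ∈ (W w).idx)
    (fun n g => ∃ c w k, n = pair (pair c w) k ∧ (g ∈ decode c ∨ (W w).Mem k g))
    inferInstance inferInstance (by
      rintro _ ⟨c, w, k, rfl, _, hk⟩
      obtain ⟨d, hd⟩ := decode_bounded c
      obtain ⟨e, he⟩ := (W w).bounded k hk
      refine ⟨max d e, ?_⟩
      rintro g ⟨c', w', k', h, hg⟩
      obtain ⟨h', rfl⟩ := pair_inj.1 h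
      obtain ⟨rfl, rfl⟩ := pair_inj.1 h'
      exact lt_max_iff.2 (hg.imp (hd g) fun h => he g h.2))

variable {Q : M.Num → M.Num → M.Num → Prop} {W : M.Num → Family M}
  (hQ : Arith fun v : Fin 3 → M.Num => Q (v 0) (v 1) (v 2)) (hW : IsFamilySeq W)

theorem members_relSeq (s : M.Num) :
    (relSeq Q W hQ hW s).members =
      {p | ∃ c w, Q s c w ∧ ∃ r ∈ (W w).members, p = decode c ∪ r} := by
  have hterm (c w k : M.Num) (hk : k ∈ (W w).idx) :
      (relSeq Q W hQ hW s).term (pair (pair c w) k) = decode c ∪ (W w).term k := by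
    ext g
    rw [Set.mem_union, mem_term_iff hk]
    constructor
    · rintro ⟨c', w', k', h, hg⟩
      obtain ⟨h', rfl⟩ := pair_inj.1 h
      obtain ⟨rfl, rfl⟩ := pair_inj.1 h'
      exact hg
    · exact fun hg => ⟨c, w, k, rfl, hg⟩
  ext p
  constructor
  · rintro ⟨_, ⟨c, w, k, rfl, hcw, hk⟩, rfl⟩
    exact ⟨c, w, hcw, _, term_mem_members hk, hterm c w k hk⟩
  · rintro ⟨c, w, hcw, _, ⟨k, hk, rfl⟩, rfl⟩
    exact ⟨_, ⟨c, w, k, rfl, hcw, hk⟩, (hterm c w k hk).symm⟩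

theorem members_relSeq_of_iff {s c : M.Num} {E : M.Num → Prop}
    (h : ∀ c' w, Q s c' w ↔ c' = c ∧ E w) :
    (relSeq Q W hQ hW s).members =
      {p | ∃ q ∈ {q | ∃ w, E w ∧ q ∈ (W w).members}, p = decode c ∪ q} := by
  rw [members_relSeq]
  ext p
  simp only [h]
  constructor
  · rintro ⟨_, w, ⟨rfl, hw⟩, q, hq, rfl⟩
    exact ⟨q, ⟨w, hw, hq⟩, rfl⟩
  · rintro ⟨q, ⟨w, hw, hq⟩, rfl⟩
    exact ⟨c, w, ⟨rfl, hw⟩, q, hq, rfl⟩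

theorem isFamilySeq_relSeq : IsFamilySeq (relSeq Q W hQ hW) := by
  have := Fact.mk hW
  have iQ {n : ℕ} (f g e : (Fin n → M.Num) → M.Num) [hf : ArithFun f] [hg : ArithFun g]
    [he : ArithFun e] : Arith fun v => Q (f v) (g v) (e v) := hQ.comp₃ hf hg he
  refine isFamilySeq_of_arith
    (inferInstanceAs (Arith fun v : Fin 2 → M.Num =>
      ∃ c w k, v 1 = pair (pair c w) k ∧ Q (v 0) c w ∧ k ∈ (W w).idx))
    (inferInstanceAs (Arith fun v : Fin 3 → M.Num =>
      (∃ c w k, v 1 = pair (pair c w) k ∧ Q (v 0) c w ∧ k ∈ (W w).idx) ∧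
        ∃ c w k, v 1 = pair (pair c w) k ∧ (v 2 ∈ decode c ∨ (W w).Mem k (v 2))))

end Family

/-! ### Trees and paths -/

/-- A tree is determined by the arithmetical relation `R` that says which children a node has. -/
theorem exists_tree (R : M.Num → M.Num → Prop)
    (hR : Arith fun v : Fin 2 → M.Num => R (v 0) (v 1)) :
    ∃ T : Set M.Num, IsTree T ∧ ∀ s m, snoc s m ∈ T ↔ s ∈ T ∧ R s m := by
  have iR {n : ℕ} (f g : (Fin n → M.Num) → M.Num) [hf : ArithFun f] [hg : ArithFun g] :
    Arith fun v => R (f v) (g v) := hR.comp₂ hf hg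
  obtain ⟨T, hT, h⟩ := exists_recursive_set (fun s : M.Num => s = 0)
    (fun t s => ∃ m, s = snoc t m ∧ R t m)
  refine ⟨T, ⟨hT, (h 0).2 (Or.inl rfl), fun s hs => ?_⟩, fun s m => ?_⟩
  · rcases (h s).1 hs with rfl | ⟨t, _, ht, m, hm, _⟩
    · exact Or.inl rfl
    · exact Or.inr ⟨t, ht, m, hm⟩
  · rw [h]
    constructor
    · rintro (h0 | ⟨t, _, ht, m', hm, hR⟩)
      · exact absurd h0.symm (zero_ne_snoc s m)
      · obtain ⟨rfl, rfl⟩ := snoc_inj.1 hm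
        exact ⟨ht, hR⟩
    · exact fun ⟨hs, hR⟩ => Or.inr ⟨s, lt_snoc s m, hs, m, rfl, hR⟩

theorem IsFun.arithFun {h : M.Num → M.Num} (hh : IsFun h) {n : ℕ} (f : (Fin n → M.Num) → M.Num)
    [hf : ArithFun f] : ArithFun fun v => h (f v) :=
  ArithFun.comp₁ ((Arith.mem hh (f := fun v : Fin 2 → M.Num => pair (v 0) (v 1))).congr fun v => by
    constructor
    · exact fun h' => ⟨v 0, by rw [h']⟩
    · rintro ⟨i, hi⟩
      obtain ⟨h0, h1⟩ := pair_inj.1 hi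
      rw [h1, h0]) hf

/-- A tree in which the root has the arithmetical property `N`, and every node with the property `N`
has a child with the property `N`, has a path: always pass to the least such child. -/
theorem exists_isPath {T : Set M.Num} (N : M.Num → Prop)
    (hN : Arith fun v : Fin 1 → M.Num => N (v 0)) (hNT : ∀ s, N s → s ∈ T) (h0 : N 0)
    (hsucc : ∀ s, N s → ∃ m, N (snoc s m)) : ∃ h, IsPath T h := by
  have iN {n : ℕ} (f : (Fin n → M.Num) → M.Num) [hf : ArithFun f] : Arith fun v => N (f v) :=
    hN.comp₁ hf
  -- `G` is the graph of the path.
  obtain ⟨G, hG, h⟩ := exists_recursive_set (fun y : M.Num => y = pair 0 0)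
    (fun t y => ∃ n s m, t = pair n s ∧ y = pair (n + 1) (snoc s m) ∧ N (snoc s m) ∧
      ∀ m', m' < m → ¬ N (snoc s m'))
  have : Fact (G ∈ M.sets) := ⟨hG⟩
  have hGzero (s : M.Num) : pair 0 s ∈ G ↔ s = 0 := by
    rw [h]
    constructor
    · rintro (h' | ⟨_, _, _, n, _, _, _, h', _⟩)
      · exact (pair_inj.1 h').2
      · exact absurd (pair_inj.1 h').1.symm (M.isACA0.add_one_ne_zero n)
    · rintro rfl
      exact Or.inl rfl
  have hGsucc (n y : M.Num) : pair (n + 1) y ∈ G ↔ ∃ s m, pair n s ∈ G ∧ y = snoc s m ∧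
      N (snoc s m) ∧ ∀ m', m' < m → ¬ N (snoc s m') := by
    rw [h]
    constructor
    · rintro (h' | ⟨_, _, ht, n', s, m, rfl, h', hm⟩)
      · exact absurd (pair_inj.1 h').1 (M.isACA0.add_one_ne_zero n)
      · obtain ⟨h1, rfl⟩ := pair_inj.1 h'
        obtain rfl := add_right_cancel h1
        exact ⟨s, m, ht, rfl, hm⟩
    · rintro ⟨s, m, hs, rfl, hm⟩
      refine Or.inr ⟨pair n s, pair_lt_pair ?_, hs, n, s, m, rfl, rfl, hm⟩
      exact add_lt_add (num_lt_add_one_iff.2 le_rfl) (lt_snoc s m)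
  have key (n : M.Num) : ∃ s, pair n s ∈ G ∧ N s ∧ ∀ s', pair n s' ∈ G → s' = s := by
    induction n using arith_induction with
    | hP => infer_instance
    | zero => exact ⟨0, (hGzero 0).2 rfl, h0, fun s' => (hGzero s').1⟩
    | succ n ih =>
      obtain ⟨s, hs, hNs, huniq⟩ := ih
      obtain ⟨m, hm, hleast⟩ := exists_least inferInstance (hsucc s hNs)
      refine ⟨snoc s m, (hGsucc _ _).2 ⟨s, m, hs, rfl, hm, hleast⟩, hm, fun y hy => ?_⟩
      obtain ⟨s', m', hs', rfl, hm', hleast'⟩ := (hGsucc _ _).1 hy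
      obtain rfl := huniq s' hs'
      obtain rfl : m' = m :=
        le_antisymm (not_lt.1 fun hlt => hleast' m hlt hm) (not_lt.1 fun hlt => hleast m' hlt hm')
      rfl
  choose f hfG hfN hfuniq using key
  refine ⟨f, ?_, ((hGzero _).1 (hfG 0)), fun n => ?_, fun n => hNT _ (hfN n)⟩
  · have hgraph : {y | ∃ i, y = pair i (f i)} = G := by
      ext y
      constructor
      · rintro ⟨i, rfl⟩
        exact hfG i
      · intro hy
        obtain ⟨i, s, rfl⟩ : ∃ i s, y = pair i s := by
          rcases (h y).1 hy with rfl | ⟨_, _, _, n, s, m, _, rfl, _⟩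
          · exact ⟨_, _, rfl⟩
          · exact ⟨_, _, rfl⟩
        exact ⟨i, by rw [hfuniq i s hy]⟩
    rw [IsFun, hgraph]
    exact hG
  · obtain ⟨s, m, hs, hm, _⟩ := (hGsucc _ _).1 (hfG (n + 1))
    exact ⟨m, by rw [hm, hfuniq n s hs]⟩

/-! ### Soundness -/

namespace PresentedFrame

variable {F : PresentedFrame M}

/-- A point of `X` that refutes the sequent at a node of a proof tree refutes the sequent at one of
the children of the node. -/
theorem Rule.exists_child {T : Set M.Num} {l r : M.Num → Family M} {s : M.Num}
    (h : F.Rule T l r s) {x : Set M.Num} (hx : x ∈ F.relationSpace) (hl : x ∈ (l s).openSet)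
    (hr : x ∉ (r s).openSet) :
    ∃ m, snoc s m ∈ T ∧ x ∈ (l (snoc s m)).openSet ∧ x ∉ (r (snoc s m)).openSet := by
  cases h with
  | ax h => exact absurd (h.openSet_subset hl) hr
  | base j c d h ha hb =>
    rw [ha.openSet_eq] at hl
    rw [hb.openSet_eq] at hr
    exact absurd ⟨h.openSet_subset hl.1, (hx.2 j).resolve_right (not_not.2 hl.2)⟩ hr
  | cut h0 h1 ha hc hb =>
    by_cases hxc : x ∈ (r (snoc s 0)).openSet
    · exact ⟨1, h1, hc.openSet_eq ▸ hxc, hb.openSet_eq ▸ hr⟩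
    · exact ⟨0, h0, ha.openSet_eq ▸ hl, hxc⟩
  | left hb ha =>
    obtain ⟨hxM, p, hp, hpx⟩ := hl
    obtain ⟨m, hm, hmp⟩ := ha p hp
    exact ⟨m, hm, hmp.mem_openSet_iff.2 ⟨hxM, hpx⟩, (hb m hm).openSet_eq ▸ hr⟩
  | right q hq m hm hb ha =>
    refine ⟨m, hm, ha.openSet_eq ▸ hl, fun hxq => hr ?_⟩
    obtain ⟨hxM, hqx⟩ := hb.mem_openSet_iff.1 hxq
    exact ⟨hxM, q, hq, hqx⟩

theorem Deduces.sound {a b : Family M} (h : F.Deduces a b) {x : Set M.Num}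
    (hx : x ∈ F.relationSpace) (ha : x ∈ a.openSet) : x ∈ b.openSet := by
  obtain ⟨T, l, r, ⟨hT, hwf⟩, hl, hr, hl0, hr0, hrule⟩ := h
  by_contra hb
  refine hwf (exists_isPath (fun s => s ∈ T ∧ x ∈ (l s).openSet ∧ x ∉ (r s).openSet) ?_
    (fun s hs => hs.1) ⟨hT.root_mem, hl0.openSet_eq ▸ ha, hr0.openSet_eq ▸ hb⟩ fun s hs => ?_)
  · have := Fact.mk hT.mem_sets
    have := Fact.mk hx.1
    have := Fact.mk hl
    have := Fact.mk hr
    simp only [Family.mem_openSet_iff hx.1]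
    infer_instance
  · exact (hrule s hs.1).exists_child hx hs.2.1 hs.2.2

end PresentedFrame

/-! ### The search tree -/

/-- The entry of a sequence that records the stage `n` of the search and the code `c` of a finite
set. It differs from `0` and `1`, which number the premises of a cut. -/
def state (n c : M.Num) : M.Num := snoc n c + 1

theorem state_inj {n c n' c' : M.Num} : state n c = state n' c' ↔ n = n' ∧ c = c' := by
  rw [state, state, add_left_inj, snoc_inj]

theorem snoc_ne_zero (s m : M.Num) : snoc s m ≠ 0 := (zero_ne_snoc s m).symm

theorem state_ne_zero (n c : M.Num) : state n c ≠ 0 := M.isACA0.add_one_ne_zero _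

theorem zero_ne_state (n c : M.Num) : 0 ≠ state n c := (state_ne_zero n c).symm

theorem state_ne_one (n c : M.Num) : state n c ≠ 1 := fun h =>
  snoc_ne_zero n c (add_right_cancel (h.trans (zero_add 1).symm))

theorem one_ne_state (n c : M.Num) : 1 ≠ state n c := (state_ne_one n c).symm

instance ArithFun.state {n : ℕ} {f g : (Fin n → M.Num) → M.Num} [ArithFun f] [ArithFun g] :
    ArithFun fun v => state (f v) (g v) := by
  unfold ACA0Model.state; infer_instance

namespace PresentedFrame

variable (F : PresentedFrame M) (a b : Family M)

/-- At stage `n` the search deals with the relation `(u_j, v_j)`, for `n = (j, k)`, and the finite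
set with the code `c` satisfies `u_j`. Every relation has its turn at unboundedly many stages. -/
def Active (n c j : M.Num) : Prop :=
  (∃ k, n = pair j k) ∧ ∃ i, i ∈ (F.u j).idx ∧ ∀ g, (F.u j).Mem i g → g ∈ decode c

theorem Active.unique {F : PresentedFrame M} {n c j j' : M.Num} (h : F.Active n c j)
    (h' : F.Active n c j') : j = j' := by
  obtain ⟨⟨k, rfl⟩, _⟩ := h
  obtain ⟨⟨k', hk⟩, _⟩ := h'
  exact (pair_inj.1 hk).1

instance : Fact (IsFamilySeq F.u) := ⟨F.u_seq⟩

instance : Fact (IsFamilySeq F.v) := ⟨F.v_seq⟩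

instance arith_active {n : ℕ} {f g e : (Fin n → M.Num) → M.Num} [hf : ArithFun f] [hg : ArithFun g]
    [he : ArithFun e] : Arith fun v => F.Active (f v) (g v) (e v) :=
  Arith.comp₃ (P := F.Active) (by unfold Active; infer_instance) hf hg he

/-- The expressions from which the sequents of the search tree are built. -/
noncomputable def labels : M.Num → Family M :=
  .sumSeq (.sumSeq F.u F.v)
    (.sumSeq (fun _ => a) (.sumSeq (fun _ => b) fun _ => .single 0))

theorem isFamilySeq_labels : IsFamilySeq (F.labels a b) :=
  Family.isFamilySeq_sumSeq (Family.isFamilySeq_sumSeq F.u_seq F.v_seq)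
    (Family.isFamilySeq_sumSeq (Family.isFamilySeq_const a)
      (Family.isFamilySeq_sumSeq (Family.isFamilySeq_const b) (Family.isFamilySeq_const _)))

instance : Fact (IsFamilySeq (F.labels a b)) := ⟨F.isFamilySeq_labels a b⟩

theorem labels_u (j : M.Num) : F.labels a b (pair 0 (pair 0 j)) = F.u j := by
  rw [labels, Family.sumSeq_left, Family.sumSeq_left]

theorem labels_v (j : M.Num) : F.labels a b (pair 0 (pair 1 j)) = F.v j := by
  rw [labels, Family.sumSeq_left, Family.sumSeq_right]

theorem labels_left : F.labels a b (pair 1 (pair 0 0)) = a := by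
  rw [labels, Family.sumSeq_right, Family.sumSeq_left]

theorem labels_right : F.labels a b (pair 1 (pair 1 (pair 0 0))) = b := by
  rw [labels, Family.sumSeq_right, Family.sumSeq_right, Family.sumSeq_left]

theorem labels_top : F.labels a b (pair 1 (pair 1 (pair 1 0))) = Family.single 0 := by
  rw [labels, Family.sumSeq_right, Family.sumSeq_right, Family.sumSeq_right]

/-- The index of the label with which the finite set with the code `c` is extended at stage `n`:
that of `v_j` if the relation `(u_j, v_j)` is active, and that of the top element otherwise. -/
def Extension (n c w : M.Num) : Prop :=
  (∃ j, F.Active n c j ∧ w = pair 0 (pair 1 j)) ∨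
    (¬ ∃ j, F.Active n c j) ∧ w = pair 1 (pair 1 (pair 1 0))

instance arith_extension {n : ℕ} {f g e : (Fin n → M.Num) → M.Num} [hf : ArithFun f]
    [hg : ArithFun g] [he : ArithFun e] : Arith fun v => F.Extension (f v) (g v) (e v) :=
  Arith.comp₃ (P := F.Extension) (by unfold Extension; infer_instance) hf hg he

/-- The finite meets that are joined in the expression `V` by which stage `n` extends the finite
set with the code `c`. -/
def extensionMembers (n c : M.Num) : Set (Set M.Num) :=
  {r | ∃ w, F.Extension n c w ∧ r ∈ (F.labels a b w).members}

/-- The left sides of the sequents of the search tree. The root has `a`; a node `σ⌢⟨(n, c)⟩` has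
the meet `p` of the finite set with the code `c`, and so have its child `0` and its grandchild
`00`; the grandchild `01` has `p ∧ u_j` and the child `1` has `p ∧ V`. -/
def LeftRel (s c w : M.Num) : Prop :=
  (s = 0 ∧ c = 0 ∧ w = pair 1 (pair 0 0)) ∨
  (∃ r n, (s = snoc r (state n c) ∨ s = snoc (snoc r (state n c)) 0 ∨
    s = snoc (snoc (snoc r (state n c)) 0) 0) ∧ w = pair 1 (pair 1 (pair 1 0))) ∨
  (∃ r n j, s = snoc (snoc (snoc r (state n c)) 0) 1 ∧ F.Active n c j ∧ w = pair 0 (pair 0 j)) ∨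
  ∃ r n, s = snoc (snoc r (state n c)) 1 ∧ F.Extension n c w

/-- The right sides of the sequents of the search tree. The root, the nodes `σ⌢⟨(n, c)⟩` and their
children `1` have `b`; the children `0` have `p ∧ V`, and the grandchildren `00` and `01` have
`p ∧ u_j` and `p ∧ v_j`. -/
def RightRel (s c w : M.Num) : Prop :=
  ((s = 0 ∨ ∃ r n c', s = snoc r (state n c') ∨ s = snoc (snoc r (state n c')) 1) ∧
    c = 0 ∧ w = pair 1 (pair 1 (pair 0 0))) ∨
  (∃ r n, s = snoc (snoc r (state n c)) 0 ∧ F.Extension n c w) ∨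
  (∃ r n j, s = snoc (snoc (snoc r (state n c)) 0) 0 ∧ F.Active n c j ∧ w = pair 0 (pair 0 j)) ∨
  ∃ r n j, s = snoc (snoc (snoc r (state n c)) 0) 1 ∧ F.Active n c j ∧ w = pair 0 (pair 1 j)

theorem arith_leftRel : Arith fun v : Fin 3 → M.Num => F.LeftRel (v 0) (v 1) (v 2) := by
  unfold LeftRel; infer_instance

theorem arith_rightRel : Arith fun v : Fin 3 → M.Num => F.RightRel (v 0) (v 1) (v 2) := by
  unfold RightRel; infer_instance

/-- The edges of the search tree. The root `a` has a child for every finite meet in `a`. A node with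
the sequent `p ⊢ b` is a leaf if `p ≤ b`, and the conclusion of a cut with the premises `p ⊢ p ∧ V`
and `p ∧ V ⊢ b` otherwise. The first premise is itself the conclusion of a cut if a relation is
active; the second one has a child for every finite meet in `p ∧ V`. -/
def Edge (t m : M.Num) : Prop :=
  (t = 0 ∧ ∃ c k, m = state 0 c ∧ k ∈ a.idx ∧ ∀ g, g ∈ decode c ↔ a.Mem k g) ∨
  (∃ r n c, t = snoc r (state n c) ∧ (¬ ∃ k, k ∈ b.idx ∧ ∀ g, b.Mem k g → g ∈ decode c) ∧
    (m = 0 ∨ m = 1)) ∨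
  (∃ r n c, t = snoc (snoc r (state n c)) 0 ∧ (∃ j, F.Active n c j) ∧ (m = 0 ∨ m = 1)) ∨
  ∃ r n c, t = snoc (snoc r (state n c)) 1 ∧ ∃ c' w k, m = state (n + 1) c' ∧ F.Extension n c w ∧
    k ∈ (F.labels a b w).idx ∧ ∀ g, g ∈ decode c' ↔ g ∈ decode c ∨ (F.labels a b w).Mem k g

-- The formula is too large for the default bound on the size of instances.
set_option synthInstance.maxSize 1000 in
theorem arith_edge : Arith fun v : Fin 2 → M.Num => F.Edge a b (v 0) (v 1) := by
  unfold Edge; infer_instance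

/-- The left side of the sequent at the node `s` of the search tree. -/
noncomputable def lhs : M.Num → Family M :=
  .relSeq F.LeftRel (F.labels a b) F.arith_leftRel (F.isFamilySeq_labels a b)

/-- The right side of the sequent at the node `s` of the search tree. -/
noncomputable def rhs : M.Num → Family M :=
  .relSeq F.RightRel (F.labels a b) F.arith_rightRel (F.isFamilySeq_labels a b)

variable {F a b}

section Nodes

attribute [local simp] snoc_inj state_inj snoc_ne_zero zero_ne_snoc state_ne_zero state_ne_one
  zero_ne_state one_ne_state

variable {r n c c' w m : M.Num}

theorem leftRel_root : F.LeftRel 0 c w ↔ c = 0 ∧ w = pair 1 (pair 0 0) := by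
  simp [LeftRel]

theorem leftRel_state : F.LeftRel (snoc r (state n c)) c' w ↔
    c' = c ∧ w = pair 1 (pair 1 (pair 1 0)) := by
  simp [LeftRel, eq_comm]

theorem leftRel_state_zero : F.LeftRel (snoc (snoc r (state n c)) 0) c' w ↔
    c' = c ∧ w = pair 1 (pair 1 (pair 1 0)) := by
  simp [LeftRel, eq_comm]

theorem leftRel_state_zero_zero : F.LeftRel (snoc (snoc (snoc r (state n c)) 0) 0) c' w ↔
    c' = c ∧ w = pair 1 (pair 1 (pair 1 0)) := by
  simp [LeftRel, eq_comm]

theorem leftRel_state_zero_one : F.LeftRel (snoc (snoc (snoc r (state n c)) 0) 1) c' w ↔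
    c' = c ∧ ∃ j, F.Active n c j ∧ w = pair 0 (pair 0 j) := by
  simp [LeftRel]
  aesop

theorem leftRel_state_one : F.LeftRel (snoc (snoc r (state n c)) 1) c' w ↔
    c' = c ∧ F.Extension n c w := by
  simp [LeftRel]
  aesop

theorem rightRel_root : F.RightRel 0 c w ↔ c = 0 ∧ w = pair 1 (pair 1 (pair 0 0)) := by
  simp [RightRel]

theorem rightRel_state : F.RightRel (snoc r (state n c)) c' w ↔
    c' = 0 ∧ w = pair 1 (pair 1 (pair 0 0)) := by
  simp [RightRel]

theorem rightRel_state_one : F.RightRel (snoc (snoc r (state n c)) 1) c' w ↔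
    c' = 0 ∧ w = pair 1 (pair 1 (pair 0 0)) := by
  simp [RightRel]

theorem rightRel_state_zero : F.RightRel (snoc (snoc r (state n c)) 0) c' w ↔
    c' = c ∧ F.Extension n c w := by
  simp [RightRel]
  aesop

theorem rightRel_state_zero_zero : F.RightRel (snoc (snoc (snoc r (state n c)) 0) 0) c' w ↔
    c' = c ∧ ∃ j, F.Active n c j ∧ w = pair 0 (pair 0 j) := by
  simp [RightRel]
  aesop

theorem rightRel_state_zero_one : F.RightRel (snoc (snoc (snoc r (state n c)) 0) 1) c' w ↔
    c' = c ∧ ∃ j, F.Active n c j ∧ w = pair 0 (pair 1 j) := by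
  simp [RightRel]
  aesop

theorem edge_root : F.Edge a b 0 m ↔ ∃ c, m = state 0 c ∧ decode c ∈ a.members := by
  simp only [Edge, zero_ne_snoc, true_and, false_and, exists_false, or_false]
  refine exists_congr fun c => ?_
  simp only [exists_and_left]
  refine and_congr_right fun _ => exists_congr fun k => and_congr_right fun hk => ?_
  simp only [Set.ext_iff, Family.mem_term_iff hk]

theorem edge_state : F.Edge a b (snoc r (state n c)) m ↔
    (¬ ∃ q ∈ b.members, q ⊆ decode c) ∧ (m = 0 ∨ m = 1) := by
  have h : (∃ q ∈ b.members, q ⊆ decode c) ↔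
      ∃ k, k ∈ b.idx ∧ ∀ g, b.Mem k g → g ∈ decode c := by
    constructor
    · rintro ⟨_, ⟨k, hk, rfl⟩, hq⟩
      exact ⟨k, hk, fun g hg => hq hg.2⟩
    · rintro ⟨k, hk, hq⟩
      exact ⟨_, Family.term_mem_members hk, fun g hg => hq g ⟨hk, hg⟩⟩
  rw [h]
  simp [Edge]

theorem edge_state_zero : F.Edge a b (snoc (snoc r (state n c)) 0) m ↔
    (∃ j, F.Active n c j) ∧ (m = 0 ∨ m = 1) := by
  simp [Edge]

theorem not_edge_state_zero_zero : ¬ F.Edge a b (snoc (snoc (snoc r (state n c)) 0) 0) m := by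
  simp [Edge]

theorem not_edge_state_zero_one : ¬ F.Edge a b (snoc (snoc (snoc r (state n c)) 0) 1) m := by
  simp [Edge]

theorem edge_state_one : F.Edge a b (snoc (snoc r (state n c)) 1) m ↔
    ∃ c', m = state (n + 1) c' ∧ ∃ q ∈ F.extensionMembers a b n c, decode c' = decode c ∪ q := by
  have h : F.Edge a b (snoc (snoc r (state n c)) 1) m ↔
      ∃ c' w k, m = state (n + 1) c' ∧ F.Extension n c w ∧ k ∈ (F.labels a b w).idx ∧
        ∀ g, g ∈ decode c' ↔ g ∈ decode c ∨ (F.labels a b w).Mem k g := by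
    simp [Edge]
  rw [h]
  refine exists_congr fun c' => ?_
  constructor
  · rintro ⟨w, k, hm, hw, hk, hg⟩
    refine ⟨hm, _, ⟨w, hw, Family.term_mem_members hk⟩, Set.ext fun g => ?_⟩
    rw [hg, Set.mem_union, Family.mem_term_iff hk]
  · rintro ⟨hm, _, ⟨w, hw, k, hk, rfl⟩, hc'⟩
    refine ⟨w, k, hm, hw, hk, fun g => ?_⟩
    rw [hc', Set.mem_union, Family.mem_term_iff hk]

end Nodes

theorem members_single_zero : (Family.single (0 : M.Num)).members = {∅} := by
  rw [show (Family.single (0 : M.Num)).members = _ from Family.single_isMeetOf 0, decode_zero]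

theorem extensionMembers_of_active {n c j : M.Num} (h : F.Active n c j) :
    F.extensionMembers a b n c = (F.v j).members := by
  ext r
  constructor
  · rintro ⟨w, ⟨j', hj', rfl⟩ | ⟨hno, _⟩, hr⟩
    · rwa [labels_v, hj'.unique h] at hr
    · exact absurd ⟨j, h⟩ hno
  · exact fun hr => ⟨_, Or.inl ⟨j, h, rfl⟩, by rwa [labels_v]⟩

theorem extensionMembers_of_not_active {n c : M.Num} (h : ¬ ∃ j, F.Active n c j) :
    F.extensionMembers a b n c = {∅} := by
  ext r
  constructor
  · rintro ⟨w, ⟨j, hj, _⟩ | ⟨_, rfl⟩, hr⟩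
    · exact absurd ⟨j, hj⟩ h
    · rwa [labels_top, members_single_zero] at hr
  · exact fun hr => ⟨_, Or.inr ⟨h, rfl⟩, by rwa [labels_top, members_single_zero]⟩

section Members

variable {r n c j : M.Num}

theorem members_active_u (h : F.Active n c j) :
    {q | ∃ w, (∃ j, F.Active n c j ∧ w = pair 0 (pair 0 j)) ∧ q ∈ (F.labels a b w).members} =
      (F.u j).members := by
  ext q
  constructor
  · rintro ⟨_, ⟨j', hj', rfl⟩, hq⟩
    rwa [labels_u, hj'.unique h] at hq
  · exact fun hq => ⟨_, ⟨j, h, rfl⟩, by rwa [labels_u]⟩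

theorem members_active_v (h : F.Active n c j) :
    {q | ∃ w, (∃ j, F.Active n c j ∧ w = pair 0 (pair 1 j)) ∧ q ∈ (F.labels a b w).members} =
      (F.v j).members := by
  ext q
  constructor
  · rintro ⟨_, ⟨j', hj', rfl⟩, hq⟩
    rwa [labels_v, hj'.unique h] at hq
  · exact fun hq => ⟨_, ⟨j, h, rfl⟩, by rwa [labels_v]⟩

theorem lhs_root_same : (F.lhs a b 0).Same a := by
  unfold Family.Same
  rw [lhs, Family.members_relSeq]
  simp [leftRel_root, labels_left, decode_zero]

theorem lhs_state : (F.lhs a b (snoc r (state n c))).IsMeetOf (decode c) := by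
  unfold Family.IsMeetOf
  rw [lhs, Family.members_relSeq]
  simp [leftRel_state, labels_top, members_single_zero]

theorem lhs_state_zero : (F.lhs a b (snoc (snoc r (state n c)) 0)).IsMeetOf (decode c) := by
  unfold Family.IsMeetOf
  rw [lhs, Family.members_relSeq]
  simp [leftRel_state_zero, labels_top, members_single_zero]

theorem lhs_state_zero_zero :
    (F.lhs a b (snoc (snoc (snoc r (state n c)) 0) 0)).IsMeetOf (decode c) := by
  unfold Family.IsMeetOf
  rw [lhs, Family.members_relSeq]
  simp [leftRel_state_zero_zero, labels_top, members_single_zero]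

theorem members_lhs_state_zero_one (h : F.Active n c j) :
    (F.lhs a b (snoc (snoc (snoc r (state n c)) 0) 1)).members =
      {p | ∃ q ∈ (F.u j).members, p = decode c ∪ q} := by
  rw [lhs, Family.members_relSeq_of_iff _ _ fun _ _ => leftRel_state_zero_one, members_active_u h]

theorem members_lhs_state_one :
    (F.lhs a b (snoc (snoc r (state n c)) 1)).members =
      {p | ∃ q ∈ F.extensionMembers a b n c, p = decode c ∪ q} :=
  Family.members_relSeq_of_iff _ _ fun _ _ => leftRel_state_one

theorem rhs_root_same : (F.rhs a b 0).Same b := by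
  unfold Family.Same
  rw [rhs, Family.members_relSeq]
  simp [rightRel_root, labels_right, decode_zero]

theorem rhs_state_same : (F.rhs a b (snoc r (state n c))).Same b := by
  unfold Family.Same
  rw [rhs, Family.members_relSeq]
  simp [rightRel_state, labels_right, decode_zero]

theorem rhs_state_one_same : (F.rhs a b (snoc (snoc r (state n c)) 1)).Same b := by
  unfold Family.Same
  rw [rhs, Family.members_relSeq]
  simp [rightRel_state_one, labels_right, decode_zero]

theorem members_rhs_state_zero :
    (F.rhs a b (snoc (snoc r (state n c)) 0)).members =
      {p | ∃ q ∈ F.extensionMembers a b n c, p = decode c ∪ q} :=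
  Family.members_relSeq_of_iff _ _ fun _ _ => rightRel_state_zero

theorem members_rhs_state_zero_zero (h : F.Active n c j) :
    (F.rhs a b (snoc (snoc (snoc r (state n c)) 0) 0)).members =
      {p | ∃ q ∈ (F.u j).members, p = decode c ∪ q} := by
  rw [rhs, Family.members_relSeq_of_iff _ _ fun _ _ => rightRel_state_zero_zero, members_active_u h]

theorem members_rhs_state_zero_one (h : F.Active n c j) :
    (F.rhs a b (snoc (snoc (snoc r (state n c)) 0) 1)).members =
      {p | ∃ q ∈ (F.v j).members, p = decode c ∪ q} := by
  rw [rhs, Family.members_relSeq_of_iff _ _ fun _ _ => rightRel_state_zero_one, members_active_v h]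

end Members

end PresentedFrame

/-! ### Completeness -/

theorem le_pair_right (i j : M.Num) : j ≤ pair i j :=
  calc
    j ≤ i + j := le_add_self
    _ ≤ (i + j) * (i + j) := le_mul_self _
    _ ≤ pair i j := le_self_add (a := (i + j) * (i + j))

theorem Family.Le.of_isMeetOf {a b : Family M} {p q : Set M.Num} (ha : a.IsMeetOf p)
    (hq : q ∈ b.members) (h : q ⊆ p) : a.Le b := by
  intro p' hp'
  rw [show a.members = _ from ha] at hp'
  obtain rfl : p' = p := hp'
  exact ⟨q, hq, h⟩

namespace PresentedFrame

variable {F : PresentedFrame M} {a b : Family M}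

section SearchTree

variable {T : Set M.Num}

theorem searchTree_rule (hT : IsTree T) (hE : ∀ s m, snoc s m ∈ T ↔ s ∈ T ∧ F.Edge a b s m)
    {s : M.Num} (hs : s ∈ T) : F.Rule T (F.lhs a b) (F.rhs a b) s := by
  have rule_root (h : (0 : M.Num) ∈ T) : F.Rule T (F.lhs a b) (F.rhs a b) 0 := by
    refine .left (fun m hm => ?_) fun p hp => ?_
    · obtain ⟨c, rfl, _⟩ := edge_root.1 ((hE _ _).1 hm).2
      exact rhs_state_same.trans rhs_root_same.symm
    · rw [show (F.lhs a b 0).members = _ from lhs_root_same] at hp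
      obtain ⟨c, rfl⟩ := Family.exists_decode_eq_of_mem_members hp
      exact ⟨state 0 c, (hE _ _).2 ⟨h, edge_root.2 ⟨c, rfl, hp⟩⟩, lhs_state⟩
  have rule_state (r n c : M.Num) (h : snoc r (state n c) ∈ T) :
      F.Rule T (F.lhs a b) (F.rhs a b) (snoc r (state n c)) := by
    by_cases hleaf : ∃ q ∈ b.members, q ⊆ decode c
    · obtain ⟨q, hq, hqc⟩ := hleaf
      rw [← show (F.rhs a b (snoc r (state n c))).members = _ from rhs_state_same] at hq
      exact .ax (.of_isMeetOf lhs_state hq hqc)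
    · refine .cut ((hE _ _).2 ⟨h, edge_state.2 ⟨hleaf, Or.inl rfl⟩⟩)
        ((hE _ _).2 ⟨h, edge_state.2 ⟨hleaf, Or.inr rfl⟩⟩) (lhs_state.trans lhs_state_zero.symm)
        (members_rhs_state_zero.trans members_lhs_state_one.symm)
        (rhs_state_one_same.trans rhs_state_same.symm)
  have rule_zero (r n c : M.Num) (h : snoc (snoc r (state n c)) 0 ∈ T) :
      F.Rule T (F.lhs a b) (F.rhs a b) (snoc (snoc r (state n c)) 0) := by
    by_cases hact : ∃ j, F.Active n c j
    · obtain ⟨j, hj⟩ := hact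
      refine .cut ((hE _ _).2 ⟨h, edge_state_zero.2 ⟨⟨j, hj⟩, Or.inl rfl⟩⟩)
        ((hE _ _).2 ⟨h, edge_state_zero.2 ⟨⟨j, hj⟩, Or.inr rfl⟩⟩)
        (lhs_state_zero.trans lhs_state_zero_zero.symm)
        ((members_rhs_state_zero_zero hj).trans (members_lhs_state_zero_one hj).symm) ?_
      unfold Family.Same
      rw [members_rhs_state_zero_one hj, members_rhs_state_zero, extensionMembers_of_active hj]
    · refine .ax (.of_isMeetOf lhs_state_zero (q := decode c ∪ ∅) ?_ (Set.union_empty _).subset)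
      rw [members_rhs_state_zero, extensionMembers_of_not_active hact]
      exact ⟨∅, rfl, rfl⟩
  have rule_zero_zero (r n c j : M.Num) (hj : F.Active n c j) :
      F.Rule T (F.lhs a b) (F.rhs a b) (snoc (snoc (snoc r (state n c)) 0) 0) := by
    obtain ⟨i, hi, hic⟩ := hj.2
    refine .ax (.of_isMeetOf lhs_state_zero_zero (q := decode c ∪ (F.u j).term i) ?_
      (Set.union_subset subset_rfl fun g hg => hic g ⟨hi, hg⟩))
    rw [members_rhs_state_zero_zero hj]
    exact ⟨_, Family.term_mem_members hi, rfl⟩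
  have rule_zero_one (r n c j : M.Num) (hj : F.Active n c j) :
      F.Rule T (F.lhs a b) (F.rhs a b) (snoc (snoc (snoc r (state n c)) 0) 1) := by
    have hsingle : (Family.single c).members = {decode c} := Family.single_isMeetOf c
    refine .base j (.single c) (.single c) (fun p hp => ⟨p, hp, subset_rfl⟩) ?_ ?_
    · unfold Family.IsInf
      rw [members_lhs_state_zero_one hj, hsingle]
      simp
    · unfold Family.IsInf
      rw [members_rhs_state_zero_one hj, hsingle]
      simp
  have rule_one (r n c : M.Num) (h : snoc (snoc r (state n c)) 1 ∈ T) :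
      F.Rule T (F.lhs a b) (F.rhs a b) (snoc (snoc r (state n c)) 1) := by
    refine .left (fun m hm => ?_) fun p hp => ?_
    · obtain ⟨c', rfl, _⟩ := edge_state_one.1 ((hE _ _).1 hm).2
      exact rhs_state_same.trans rhs_state_one_same.symm
    · obtain ⟨c', rfl⟩ := Family.exists_decode_eq_of_mem_members hp
      rw [members_lhs_state_one] at hp
      obtain ⟨q, hq, hc'⟩ := hp
      exact ⟨state (n + 1) c', (hE _ _).2 ⟨h, edge_state_one.2 ⟨c', rfl, q, hq, hc'⟩⟩, lhs_state⟩
  rcases hT.parent s hs with rfl | ⟨t, -, m, rfl⟩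
  · exact rule_root hs
  rcases ((hE t m).1 hs).2 with ⟨rfl, c, k, rfl, _⟩ | ⟨r, n, c, rfl, _, rfl | rfl⟩ |
    ⟨r, n, c, rfl, ⟨j, hj⟩, rfl | rfl⟩ | ⟨r, n, c, rfl, c', w, k, rfl, _⟩
  · exact rule_state _ _ _ hs
  · exact rule_zero _ _ _ hs
  · exact rule_one _ _ _ hs
  · exact rule_zero_zero _ _ _ _ hj
  · exact rule_zero_one _ _ _ _ hj
  · exact rule_state _ _ _ hs

/-- Along a path of the search tree, stage `n` of the search is reached at the node of length
`2 n + 1`, by the right premises of the cuts. -/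
theorem exists_state_of_isPath (hE : ∀ s m, snoc s m ∈ T ↔ s ∈ T ∧ F.Edge a b s m)
    {h : M.Num → M.Num} (hh : IsPath T h) (n : M.Num) :
    ∃ r c, h (n + n + 1) = snoc r (state n c) := by
  obtain ⟨hfun, h0, hsucc, hmem⟩ := hh
  have ih {n : ℕ} (f : (Fin n → M.Num) → M.Num) [hf : ArithFun f] : ArithFun fun v => h (f v) :=
    hfun.arithFun f
  have edge (k : M.Num) : ∃ m, h (k + 1) = snoc (h k) m ∧ F.Edge a b (h k) m := by
    obtain ⟨m, hm⟩ := hsucc k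
    exact ⟨m, hm, ((hE _ _).1 (hm ▸ hmem (k + 1))).2⟩
  induction n using arith_induction with
  | hP => infer_instance
  | zero =>
    obtain ⟨m, hm, he⟩ := edge 0
    rw [h0] at hm he
    obtain ⟨c, rfl, _⟩ := edge_root.1 he
    exact ⟨0, c, by rw [add_zero, hm]⟩
  | succ n ih =>
    obtain ⟨r, c, hn⟩ := ih
    obtain ⟨m₁, hm₁, he₁⟩ := edge (n + n + 1)
    obtain ⟨m₂, hm₂, he₂⟩ := edge (n + n + 1 + 1)
    obtain ⟨m₃, hm₃, he₃⟩ := edge (n + n + 1 + 1 + 1)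
    rw [hm₂] at he₃
    rw [hm₁] at hm₂ he₂ he₃
    rw [hn] at hm₂ he₁ he₂ he₃
    rcases (edge_state.1 he₁).2 with rfl | rfl
    · rcases (edge_state_zero.1 he₂).2 with rfl | rfl
      · exact absurd he₃ not_edge_state_zero_zero
      · exact absurd he₃ not_edge_state_zero_one
    · obtain ⟨c', rfl, _⟩ := edge_state_one.1 he₂
      refine ⟨_, c', Eq.trans ?_ hm₂⟩
      congr 1
      ring

/-- The union of the finite sets along a path of the search tree is a point of `X` that refutes the
sequent at the root. -/
theorem exists_point_of_isPath (hE : ∀ s m, snoc s m ∈ T ↔ s ∈ T ∧ F.Edge a b s m)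
    {h : M.Num → M.Num} (hh : IsPath T h) :
    ∃ x ∈ F.relationSpace, x ∈ a.openSet ∧ x ∉ b.openSet := by
  choose r c hc using exists_state_of_isPath hE hh
  obtain ⟨hfun, h0, hsucc, hmem⟩ := hh
  have ih {n : ℕ} (f : (Fin n → M.Num) → M.Num) [hf : ArithFun f] : ArithFun fun v => h (f v) :=
    hfun.arithFun f
  have ic {n : ℕ} (f : (Fin n → M.Num) → M.Num) [hf : ArithFun f] : ArithFun fun v => c (f v) :=
    ArithFun.comp₁ (Arith.congr (P := fun v : Fin 2 → M.Num =>
      ∃ r, h (v 0 + v 0 + 1) = snoc r (state (v 0) (v 1))) inferInstance fun v => by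
        simp [hc, snoc_inj, state_inj, eq_comm]) hf
  have edge (k : M.Num) : ∃ m, h (k + 1) = snoc (h k) m ∧ F.Edge a b (h k) m := by
    obtain ⟨m, hm⟩ := hsucc k
    exact ⟨m, hm, ((hE _ _).1 (hm ▸ hmem (k + 1))).2⟩
  have hzero : decode (c 0) ∈ a.members := by
    obtain ⟨m, hm, he⟩ := edge 0
    rw [h0] at hm he
    obtain ⟨c', rfl, hc'⟩ := edge_root.1 he
    have h1 := hc 0
    rw [add_zero, hm] at h1
    rwa [(state_inj.1 (snoc_inj.1 h1).2).2] at hc'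
  have hstep (n : M.Num) : (¬ ∃ q ∈ b.members, q ⊆ decode (c n)) ∧
      ∃ q ∈ F.extensionMembers a b n (c n), decode (c (n + 1)) = decode (c n) ∪ q := by
    obtain ⟨m₁, hm₁, he₁⟩ := edge (n + n + 1)
    obtain ⟨m₂, hm₂, he₂⟩ := edge (n + n + 1 + 1)
    have h1 := hc (n + 1)
    rw [show n + 1 + (n + 1) + 1 = n + n + 1 + 1 + 1 by ring, hm₂] at h1
    rw [hm₁] at he₂
    rw [hc n] at he₁ he₂
    obtain ⟨hleaf, hm⟩ := edge_state.1 he₁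
    refine ⟨hleaf, ?_⟩
    obtain rfl : m₂ = state (n + 1) (c (n + 1)) := (snoc_inj.1 h1).2
    rcases hm with rfl | rfl
    · rcases (edge_state_zero.1 he₂).2 with h' | h'
      · exact absurd h' (state_ne_zero _ _)
      · exact absurd h' (state_ne_one _ _)
    · obtain ⟨c', h', hq⟩ := edge_state_one.1 he₂
      rwa [← (state_inj.1 h').2] at hq
  have hmono {n m : M.Num} (hnm : n ≤ m) : ∀ g, g ∈ decode (c n) → g ∈ decode (c m) := by
    obtain ⟨d, rfl⟩ := exists_add_of_le hnm
    clear hnm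
    induction d using arith_induction with
    | hP => infer_instance
    | zero => simp
    | succ d ihd =>
      intro g hg
      obtain ⟨q, _, hq⟩ := (hstep (n + d)).2
      rw [← add_assoc, hq]
      exact Or.inl (ihd g hg)
  have hx : {g | ∃ n, g ∈ decode (c n)} ∈ M.sets :=
    mem_sets_of_arith (P := fun g => ∃ n, g ∈ decode (c n))
  -- A finite subset of the union is included in one of the sets.
  have hfin {e : Family M} {q : Set M.Num} (hq : q ∈ e.members)
      (hqx : q ⊆ {g | ∃ n, g ∈ decode (c n)}) : ∃ n, q ⊆ decode (c n) := by
    obtain ⟨d, rfl⟩ := Family.exists_decode_eq_of_mem_members hq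
    obtain ⟨B, hB⟩ := decode_bounded d
    suffices ∃ n, ∀ g, g < B → g ∈ decode d → g ∈ decode (c n) by
      obtain ⟨n, hn⟩ := this
      exact ⟨n, fun g hg => hn g (hB g hg) hg⟩
    clear hB
    induction B using arith_induction with
    | hP => infer_instance
    | zero => exact ⟨0, fun g hg => absurd hg (M.isACA0.not_lt_zero g)⟩
    | succ B ihB =>
      obtain ⟨n, hn⟩ := ihB
      by_cases hBd : B ∈ decode d
      · obtain ⟨m, hm⟩ := hqx hBd
        refine ⟨max n m, fun g hg hgd => ?_⟩
        rcases (M.isACA0.lt_add_one_iff g B).1 hg with hg | rfl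
        · exact hmono (le_max_left n m) g (hn g hg hgd)
        · exact hmono (le_max_right n m) g hm
      · refine ⟨n, fun g hg hgd => ?_⟩
        rcases (M.isACA0.lt_add_one_iff g B).1 hg with hg | rfl
        · exact hn g hg hgd
        · exact absurd hgd hBd
  refine ⟨_, ⟨hx, fun j => ?_⟩, ⟨hx, _, hzero, fun g hg => ⟨0, hg⟩⟩, ?_⟩
  · rw [or_iff_not_imp_right, not_not]
    rintro ⟨_, p, hp, hpx⟩
    obtain ⟨k, hk⟩ := hfin hp hpx
    obtain ⟨i, hi, rfl⟩ := hp
    -- The stage `(j, k)` comes after `k` and deals with the relation `(u_j, v_j)`.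
    have hact : F.Active (pair j k) (c (pair j k)) j :=
      ⟨⟨k, rfl⟩, i, hi, fun g hg => hmono (le_pair_right j k) g (hk hg.2)⟩
    obtain ⟨q, hq, hq'⟩ := (hstep (pair j k)).2
    rw [extensionMembers_of_active hact] at hq
    exact ⟨hx, q, hq, fun g hg => ⟨pair j k + 1, by rw [hq']; exact Or.inr hg⟩⟩
  · rintro ⟨_, q, hq, hqx⟩
    obtain ⟨n, hn⟩ := hfin hq hqx
    exact (hstep n).1 ⟨q, hq, hn⟩

end SearchTree

theorem Deduces.complete (h : ∀ x ∈ F.relationSpace, x ∈ a.openSet → x ∈ b.openSet) :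
    F.Deduces a b := by
  obtain ⟨T, hT, hE⟩ := exists_tree (F.Edge a b) (F.arith_edge a b)
  refine ⟨T, F.lhs a b, F.rhs a b, ⟨hT, ?_⟩, Family.isFamilySeq_relSeq _ _,
    Family.isFamilySeq_relSeq _ _, lhs_root_same, rhs_root_same,
    fun s hs => searchTree_rule hT hE hs⟩
  rintro ⟨f, hf⟩
  obtain ⟨x, hx, hxa, hxb⟩ := exists_point_of_isPath hE hf
  exact hxb (h x hx hxa)

/-! ### The space of points and spatiality -/

theorem pointSpace_eq_relationSpace (F : PresentedFrame M) : F.pointSpace = F.relationSpace := by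
  ext x
  constructor
  · exact fun ⟨hx, h⟩ => ⟨hx, fun j => or_iff_not_imp_right.2 fun hu => h.of_rel j (not_not.1 hu)⟩
  · exact fun ⟨hx, h⟩ => ⟨hx, fun a b hab => fun ha => hab.openSet_subset ha,
      fun j hu => (h j).resolve_right (not_not.2 hu), fun a b c hab hbc => hbc ∘ hab⟩

theorem isSpatialVia_relationSpace (F : PresentedFrame M) :
    IsSpatialVia F.Deduces F.relationSpace fun a => F.relationSpace ∩ a.openSet where
  isOpen a := ⟨a, rfl⟩
  surjective := by
    rintro _ ⟨a, rfl⟩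
    exact ⟨a, rfl⟩
  exists_top := ⟨.single 0, decode_zero (M := M) ▸ Family.single_isMeetOf 0⟩
  map_top c hc := Set.inter_eq_left.2 fun x hx => hc.mem_openSet_iff.2 ⟨hx.1, Set.empty_subset x⟩
  exists_inf := Family.exists_isInf
  map_inf a b c hc := by
    rw [hc.openSet_eq, Set.inter_inter_distrib_left]
  exists_sup s hs := Family.exists_isSup hs
  map_sup s c _ hc := by
    rw [hc.openSet_eq, Set.inter_iUnion]
  le_iff a b := ⟨fun h x hx hxa => ⟨hx, h.sound hx hxa.2⟩,
    fun h => Deduces.complete fun x hx hxa => (h x hx ⟨hx, hxa⟩).2⟩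

end PresentedFrame

end ACA0Model

theorem mainTheorem4 (M : ACA0Model.{u}) (F : M.PresentedFrame) :
    ACA0Model.IsPi02 F.relationSpace ∧
    F.pointSpace = F.relationSpace ∧
    ACA0Model.IsSpatialVia F.Deduces F.relationSpace
      (fun a : M.Family => F.relationSpace ∩ a.openSet) :=
  ⟨⟨F.v, F.u, F.v_seq, F.u_seq, rfl⟩, F.pointSpace_eq_relationSpace, F.isSpatialVia_relationSpace⟩
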